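/- Let $N\ge 1$ be an integer and let $p\ge 1$, $r>1$ and $0<\gamma<\min\{N,2\}$ be real numbers. Put $$r_2=\frac{N(rp+r-p)}{r(N-\gamma)},\qquad \alpha=\frac{p(r-1)}{r}.$$ There is a constant $C=C(p,r,\gamma,N)>0$ such that every real-valued $v\in L^p(\mathbb{R}^N)$ with $(-\Delta)^{\gamma/2}v\in L^r(\mathbb{R}^N)$ belongs to $L^{r_2}(\mathbb{R}^N)$ and satisfies $$\|v\|_{r_2}^{\alpha+1}\le C\,\|(-\Delta)^{\gamma/2}v\|_r\,\|v\|_p^{\alpha}.$$ Here $\|\cdot\|_s$ is the norm of $L^s(\mathbb{R}^N)$. For a Schwartz function $\varphi$, $(-\Delta)^{\gamma/2}\varphi$ is the function whose Fourier transform is $|\xi|^\gamma\widehat\varphi(\xi)$; for $v\in L^p(\mathbb{R}^N)$, $(-\Delta)^{\gamma/2}v$ is understood in the sense of distributions, that is, $(-\Delta)^{\gamma/2}v=w\in L^r(\mathbb{R}^N)$ means that $\int_{\mathbb{R}^N} v\,(-\Delta)^{\gamma/2}\varphi\,dx=\int_{\mathbb{R}^N} w\,\varphi\,dx$ for every Schwartz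 function $\varphi$. No relation between $N$ and $\gamma r$ is assumed; in particular the case $N\le\gamma r$ is included. -/

import Mathlib

open MeasureTheory
open scoped FourierTransform SchwartzMap

noncomputable section

/-- The fractional Laplacian `(-Δ)^(γ/2)` of a Schwartz function on `ℝ^N`: the Fourier multiplier
with symbol `|ξ|^γ`. Mathlib's Fourier transform uses the frequency variable `η = ξ / (2π)`, so that
the symbol reads `(2π|η|)^γ`. -/
def schwartzFracLaplacian {N : ℕ} (γ : ℝ) (φ : 𝓢(EuclideanSpace ℝ (Fin N), ℂ)) :
    EuclideanSpace ℝ (Fin N) → ℂ :=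
  𝓕⁻ (fun η : EuclideanSpace ℝ (Fin N) =>
    (((2 * Real.pi * ‖η‖) ^ γ : ℝ) : ℂ) * 𝓕 (φ : EuclideanSpace ℝ (Fin N) → ℂ) η)

/-- `w = (-Δ)^(γ/2) v` in the sense of distributions, for real functions `v, w` on `ℝ^N`:
`∫ v (-Δ)^(γ/2) φ = ∫ w φ` for every Schwartz function `φ`. For `0 < γ` and `φ` a Schwartz function,
`(-Δ)^(γ/2) φ` is continuous and `O((1 + |x|)^(-N-γ))`, so that both integrals converge absolutely
whenever `v` and `w` belong to Lebesgue spaces with exponents at least `1`. -/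
def IsFracLaplacian {N : ℕ} (γ : ℝ) (v w : EuclideanSpace ℝ (Fin N) → ℝ) : Prop :=
  ∀ φ : 𝓢(EuclideanSpace ℝ (Fin N), ℂ),
    ∫ x, (v x : ℂ) * schwartzFracLaplacian γ φ x = ∫ x, (w x : ℂ) * φ x

end

open Metric Set Filter Topology Module
open scoped ENNReal

/-! ### Two-sided geometric sums -/

/-! The proof is Hedberg's pointwise argument, run on Littlewood–Paley pieces. Let `w = (-Δ)^(γ/2)
v`, `A = ‖w‖_r`, `B = ‖v‖_p`, let `M` be the maximal function of `w`, and split `v = ∑ⱼ vⱼ` with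
`vⱼ` at frequency `2^j`. Bernstein's inequality gives `|vⱼ| ≲ 2^(jN/p) B`. Moreover `vⱼ` is
`2^(-jγ)` times an average of `w` against a dilated Schwartz kernel, so `|vⱼ| ≲ 2^(-jγ) min
(2^(jN/r) A) M`, hence `|vⱼ| ≲ 2^(-jb) A^(1-s) M^s` with `b = γ - (1-s)N/r`. Summing the smaller of
a growing and a decaying geometric bound (`ENNReal.exists_tsum_int_min_le`) gives `|v| ≲ B^(1-θ)
(A^(1-s) M^s)^θ` with `θ = (N/p)/(N/p+b)` (`exists_ae_enorm_le`). The maximal theorem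
(`exists_lintegral_dyadicMaximal_rpow_le`) turns this into `‖v‖_q ≲ B^(1-θ) A^θ` for `q = r/(sθ)`
(`exists_eLpNorm_le`).

The parameter `s` covers all ranges of exponents. If `γ ≤ N(1-1/r)`, then `s = 1` gives `θ ≥
1/(α+1)`, and interpolation with `L^p` lowers the weight of `A` to exactly `1/(α+1)`. For larger `γ`
that `θ` would be too small, and interpolation with `L^p` cannot raise it; `s = r(1-γ/N) < 1`
instead makes `b = N(1-1/r)`, so that `θ = 1/(α+1)` and `q = r₂` at once. -/

theorem ENNReal.two_rpow_ne_zero (a : ℝ) : (2 : ℝ≥0∞) ^ a ≠ 0 :=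
  (ENNReal.rpow_pos (by norm_num) (by norm_num)).ne'

theorem ENNReal.two_rpow_ne_top (a : ℝ) : (2 : ℝ≥0∞) ^ a ≠ ∞ :=
  ENNReal.rpow_ne_top_of_ne_zero (by norm_num) (by norm_num)

theorem ENNReal.two_rpow_add (a b : ℝ) : (2 : ℝ≥0∞) ^ (a + b) = 2 ^ a * 2 ^ b :=
  ENNReal.rpow_add _ _ (by norm_num) (by norm_num)

theorem ENNReal.ofReal_two_rpow (a : ℝ) : ENNReal.ofReal ((2 : ℝ) ^ a) = 2 ^ a := by
  rw [← ENNReal.ofReal_rpow_of_pos (by norm_num)]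
  norm_num

theorem ENNReal.exists_eq_two_rpow {X : ℝ≥0∞} (h0 : X ≠ 0) (ht : X ≠ ∞) :
    ∃ x : ℝ, X = 2 ^ x := by
  refine ⟨Real.logb 2 X.toReal, ?_⟩
  rw [← ENNReal.ofReal_two_rpow, Real.rpow_logb (by norm_num) (by norm_num)
    (ENNReal.toReal_pos h0 ht), ENNReal.ofReal_toReal ht]

theorem ENNReal.tsum_int_two_rpow_neg_abs_ne_top {c : ℝ} (hc : 0 < c) :
    ∑' j : ℤ, (2 : ℝ≥0∞) ^ (-c * |(j : ℝ)|) ≠ ∞ := by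
  have hs : Summable fun j : ℤ => (2 : ℝ) ^ (-c * |(j : ℝ)|) := by
    have hg : Summable fun n : ℕ => ((2 : ℝ) ^ (-c)) ^ n :=
      summable_geometric_of_lt_one (by positivity)
        (Real.rpow_lt_one_of_one_lt_of_neg (by norm_num) (by linarith))
    rw [summable_int_iff_summable_nat_and_neg]
    constructor <;> refine hg.congr fun n => ?_ <;>
      simp [← Real.rpow_mul_natCast]
  have h := hs.tsum_ofReal_ne_top
  simpa only [ENNReal.ofReal_two_rpow] using h

/-- `∑ⱼ min (2^(ja) X) (2^(-jb) Y)`, over all integers `j`, is bounded by the geometric mean of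
`X` and `Y` that is homogeneous under the scaling of the sum. -/
theorem ENNReal.exists_tsum_int_min_le {a b : ℝ} (ha : 0 < a) (hb : 0 < b) :
    ∃ C : ℝ≥0∞, C ≠ 0 ∧ C ≠ ∞ ∧ ∀ X Y : ℝ≥0∞,
      ∑' j : ℤ, min (2 ^ ((j : ℝ) * a) * X) (2 ^ (-((j : ℝ) * b)) * Y) ≤
        C * (X ^ (b / (a + b)) * Y ^ (a / (a + b))) := by
  set c := min a b with hcdef
  have hc : 0 < c := lt_min ha hb
  have hab : 0 < a + b := by positivity
  have hθ : 0 < a / (a + b) := by positivity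
  have hθ' : 0 < b / (a + b) := by positivity
  have hsum := ENNReal.tsum_int_two_rpow_neg_abs_ne_top hc
  have hsum0 : ∑' j : ℤ, (2 : ℝ≥0∞) ^ (-c * |(j : ℝ)|) ≠ 0 := by
    intro h
    rw [ENNReal.tsum_eq_zero] at h
    exact ENNReal.two_rpow_ne_zero _ (h 0)
  refine ⟨2 ^ c * ∑' j : ℤ, (2 : ℝ≥0∞) ^ (-c * |(j : ℝ)|),
    mul_ne_zero (ENNReal.two_rpow_ne_zero _) hsum0,
    ENNReal.mul_ne_top (ENNReal.two_rpow_ne_top _) hsum, fun X Y => ?_⟩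
  rcases eq_or_ne X 0 with rfl | hX0
  · simp
  rcases eq_or_ne Y 0 with rfl | hY0
  · simp
  have hC0 : 2 ^ c * ∑' j : ℤ, (2 : ℝ≥0∞) ^ (-c * |(j : ℝ)|) ≠ 0 :=
    mul_ne_zero (ENNReal.two_rpow_ne_zero _) hsum0
  have htop : X = ∞ ∨ Y = ∞ → X ^ (b / (a + b)) * Y ^ (a / (a + b)) = ∞ := by
    rintro (rfl | rfl)
    · rw [ENNReal.top_rpow_of_pos hθ', ENNReal.top_mul]
      simp [hY0, hθ.not_gt]
    · rw [ENNReal.top_rpow_of_pos hθ, ENNReal.mul_top]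
      simp [hX0, hθ'.not_gt]
  by_cases ht : X = ∞ ∨ Y = ∞
  · rw [htop ht, ENNReal.mul_top hC0]
    exact le_top
  push Not at ht
  obtain ⟨x, rfl⟩ := ENNReal.exists_eq_two_rpow hX0 ht.1
  obtain ⟨y, rfl⟩ := ENNReal.exists_eq_two_rpow hY0 ht.2
  -- The two bounds balance at the real index `t`, with common value `2^z`. Away from `t` the
  -- minimum decays at rate at least `c`; replacing `t` by `⌊t⌋` costs the factor `2^c`.
  set t := (y - x) / (a + b) with htdef
  set z := x * (b / (a + b)) + y * (a / (a + b)) with hz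
  have hzx : x = z - t * a := by rw [hz, htdef]; field_simp; ring
  have hzy : y = z + t * b := by rw [hz, htdef]; field_simp; ring
  rw [← ENNReal.rpow_mul, ← ENNReal.rpow_mul, ← ENNReal.two_rpow_add, ← hz]
  have hterm : ∀ j : ℤ, min ((2 : ℝ≥0∞) ^ ((j : ℝ) * a) * 2 ^ x) (2 ^ (-((j : ℝ) * b)) * 2 ^ y) ≤
      2 ^ c * 2 ^ z * 2 ^ (-c * |((j - ⌊t⌋ : ℤ) : ℝ)|) := by
    intro j
    simp only [← ENNReal.two_rpow_add]
    rcases le_or_gt t j with h | h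
    · refine (min_le_right _ _).trans (ENNReal.rpow_le_rpow_of_exponent_le (by norm_num) ?_)
      have h1 : ⌊t⌋ ≤ j := by
        have := Int.floor_le t
        exact_mod_cast this.trans h
      have h2 : (0 : ℝ) ≤ ((j - ⌊t⌋ : ℤ) : ℝ) := by exact_mod_cast sub_nonneg.2 h1
      rw [abs_of_nonneg h2]
      push_cast
      have h3 := Int.lt_floor_add_one t
      have h4 : ((j : ℝ) - t) * c ≤ (j - t) * b :=
        mul_le_mul_of_nonneg_left (min_le_right _ _) (sub_nonneg.2 h)
      have h5 : c * (j - ⌊t⌋) ≤ c * (j - t + 1) :=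
        mul_le_mul_of_nonneg_left (by linarith) hc.le
      rw [hzy]
      linarith
    · refine (min_le_left _ _).trans (ENNReal.rpow_le_rpow_of_exponent_le (by norm_num) ?_)
      have h1 : j ≤ ⌊t⌋ := Int.le_floor.2 h.le
      have h2 : ((j - ⌊t⌋ : ℤ) : ℝ) ≤ 0 := by exact_mod_cast sub_nonpos.2 h1
      rw [abs_of_nonpos h2]
      push_cast
      have h3 := Int.floor_le t
      have h4 : (t - j) * c ≤ (t - j) * a :=
        mul_le_mul_of_nonneg_left (min_le_left _ _) (sub_nonneg.2 h.le)
      have h5 : c * (⌊t⌋ - j) ≤ c * (t - j) :=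
        mul_le_mul_of_nonneg_left (by linarith) hc.le
      rw [hzx]
      linarith
  refine (ENNReal.tsum_le_tsum hterm).trans ?_
  rw [ENNReal.tsum_mul_left]
  have hshift : ∑' j : ℤ, (2 : ℝ≥0∞) ^ (-c * |((j - ⌊t⌋ : ℤ) : ℝ)|) =
      ∑' j : ℤ, (2 : ℝ≥0∞) ^ (-c * |(j : ℝ)|) :=
    (Equiv.subRight ⌊t⌋).tsum_eq fun j : ℤ => (2 : ℝ≥0∞) ^ (-c * |(j : ℝ)|)
  rw [hshift]
  exact le_of_eq (by ring)

/-! ### The dyadic maximal function -/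

section MaximalFunction

set_option linter.unusedSectionVars false

variable {E : Type*} [NormedAddCommGroup E] [NormedSpace ℝ E] [FiniteDimensional ℝ E]
  [MeasurableSpace E] [BorelSpace E] (μ : Measure E) [μ.IsAddHaarMeasure]

/-- The mean of `f` over the closed ball of centre `x` and radius `2^k`, up to the volume of the
unit ball. -/
noncomputable def dyadicMean (f : E → ℝ≥0∞) (k : ℤ) (x : E) : ℝ≥0∞ :=
  2 ^ (-((k : ℝ) * finrank ℝ E)) * ∫⁻ y in closedBall x ((2 : ℝ) ^ (k : ℝ)), f y ∂μ

/-- The centred Hardy–Littlewood maximal function, over balls of dyadic radius. -/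
noncomputable def dyadicMaximal (f : E → ℝ≥0∞) (x : E) : ℝ≥0∞ := ⨆ k : ℤ, dyadicMean μ f k x

theorem dyadicMean_le_dyadicMaximal (f : E → ℝ≥0∞) (k : ℤ) (x : E) :
    dyadicMean μ f k x ≤ dyadicMaximal μ f x :=
  le_iSup (fun k => dyadicMean μ f k x) k

theorem measure_closedBall_two_rpow (x : E) (k : ℝ) :
    μ (closedBall x ((2 : ℝ) ^ k)) = 2 ^ (k * finrank ℝ E) * μ (closedBall 0 1) := by
  rw [Measure.addHaar_closedBall' μ x (by positivity), ← Real.rpow_mul_natCast (by norm_num),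
    ENNReal.ofReal_two_rpow]

theorem measurable_dyadicMean {f : E → ℝ≥0∞} (hf : Measurable f) (k : ℤ) :
    Measurable (dyadicMean μ f k) := by
  refine Measurable.const_mul ?_ _
  -- As a section integral of a jointly measurable function, the mean is measurable in the centre.
  have h : ∀ x : E, ∫⁻ y in closedBall x ((2 : ℝ) ^ (k : ℝ)), f y ∂μ =
      ∫⁻ y, ({q : E × E | dist q.2 q.1 ≤ (2 : ℝ) ^ (k : ℝ)}.indicator fun q => f q.2) (x, y) ∂μ := by
    intro x
    rw [← lintegral_indicator measurableSet_closedBall]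
    rfl
  simp_rw [h]
  refine Measurable.lintegral_prod_right' (Measurable.indicator (hf.comp measurable_snd) ?_)
  exact (isClosed_le (by fun_prop) continuous_const).measurableSet

theorem measurable_dyadicMaximal {f : E → ℝ≥0∞} (hf : Measurable f) :
    Measurable (dyadicMaximal μ f) :=
  Measurable.iSup fun k => measurable_dyadicMean μ hf k

theorem dyadicMaximal_congr_ae {f g : E → ℝ≥0∞} (h : f =ᵐ[μ] g) :
    dyadicMaximal μ f = dyadicMaximal μ g := by
  ext x
  unfold dyadicMaximal dyadicMean
  simp_rw [lintegral_congr_ae (ae_restrict_of_ae h)]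

/-- The weak type `(1, 1)` estimate for the maximal function. -/
theorem mul_measure_lt_dyadicMaximal_le [Nontrivial E] (f : E → ℝ≥0∞) (l : ℝ≥0∞) :
    l * μ {x | l < dyadicMaximal μ f x} ≤
      ENNReal.ofReal (5 ^ finrank ℝ E) * μ (closedBall 0 1) * ∫⁻ y, f y ∂μ := by
  set d := finrank ℝ E with hd
  have hd0 : d ≠ 0 := finrank_pos.ne'
  set V := μ (closedBall (0 : E) 1) with hV
  have hV0 : V ≠ 0 := (measure_closedBall_pos μ 0 one_pos).ne'
  rcases eq_or_ne l 0 with rfl | hl0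
  · simp
  rcases eq_or_ne l ∞ with rfl | hlt
  · simp
  rcases eq_or_ne (∫⁻ y, f y ∂μ) ∞ with hI | hI
  · rw [hI, ENNReal.mul_top]
    · exact le_top
    · exact mul_ne_zero (by simp) hV0
  let t : Set (E × ℤ) := {q | l < dyadicMean μ f q.2 q.1}
  have ht : ∀ q ∈ t, l * 2 ^ ((q.2 : ℝ) * d) ≤
      ∫⁻ y in closedBall q.1 ((2 : ℝ) ^ (q.2 : ℝ)), f y ∂μ := by
    intro q hq
    have hq' : l < dyadicMean μ f q.2 q.1 := hq
    calc l * 2 ^ ((q.2 : ℝ) * d) ≤ dyadicMean μ f q.2 q.1 * 2 ^ ((q.2 : ℝ) * d) := by gcongr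
      _ = (2 ^ (-((q.2 : ℝ) * d)) * 2 ^ ((q.2 : ℝ) * d)) *
          ∫⁻ y in closedBall q.1 ((2 : ℝ) ^ (q.2 : ℝ)), f y ∂μ := by
        unfold dyadicMean; ring
      _ = _ := by rw [← ENNReal.two_rpow_add]; simp
  -- Vitali's covering lemma needs bounded radii. A radius above `1` is at most its `d`-th power,
  -- which the mass of `f` controls.
  have hbdd : ∀ q ∈ t, (2 : ℝ) ^ (q.2 : ℝ) ≤ max 1 ((∫⁻ y, f y ∂μ) / l).toReal := by
    intro q hq
    rcases le_or_gt ((2 : ℝ) ^ (q.2 : ℝ)) 1 with h1 | h1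
    · exact h1.trans (le_max_left _ _)
    refine le_trans ?_ (le_max_right _ _)
    refine (le_self_pow₀ h1.le hd0).trans ?_
    rw [← ENNReal.ofReal_le_iff_le_toReal (ENNReal.div_ne_top hI hl0),
      ENNReal.le_div_iff_mul_le (Or.inl hl0) (Or.inl hlt), ← Real.rpow_mul_natCast (by norm_num),
      ENNReal.ofReal_two_rpow, mul_comm]
    exact (ht q hq).trans (setLIntegral_le_lintegral _ _)
  obtain ⟨u, hut, hdisj, hcov⟩ := Vitali.exists_disjoint_subfamily_covering_enlargement_closedBall
    t (fun q => q.1) (fun q => (2 : ℝ) ^ (q.2 : ℝ)) _ hbdd 5 (by norm_num)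
  have hu : u.Countable := hdisj.countable_of_nonempty_interior fun q _ => by
    refine ⟨q.1, ball_subset_interior_closedBall (mem_ball_self (by positivity))⟩
  have hsub : {x | l < dyadicMaximal μ f x} ⊆
      ⋃ q ∈ u, closedBall q.1 (5 * (2 : ℝ) ^ (q.2 : ℝ)) := by
    intro x hx
    obtain ⟨k, hk⟩ := lt_iSup_iff.1 (show l < ⨆ k : ℤ, dyadicMean μ f k x from hx)
    obtain ⟨q, hq, hq'⟩ := hcov (x, k) hk
    exact mem_biUnion hq (hq' (mem_closedBall_self (by positivity)))
  have : Countable u := hu.to_subtype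
  calc l * μ {x | l < dyadicMaximal μ f x}
      ≤ l * ∑' q : u, μ (closedBall q.1.1 (5 * (2 : ℝ) ^ (q.1.2 : ℝ))) := by
        gcongr
        exact (measure_mono hsub).trans (measure_biUnion_le _ hu _)
    _ = ENNReal.ofReal (5 ^ d) * V * ∑' q : u, l * 2 ^ ((q.1.2 : ℝ) * d) := by
        rw [← ENNReal.tsum_mul_left, ← ENNReal.tsum_mul_left]
        refine tsum_congr fun q => ?_
        rw [Measure.addHaar_closedBall' μ _ (by positivity), mul_pow,
          ENNReal.ofReal_mul (by positivity), ← Real.rpow_mul_natCast (by norm_num),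
          ENNReal.ofReal_two_rpow]
        ring
    _ ≤ ENNReal.ofReal (5 ^ d) * V *
          ∑' q : u, ∫⁻ y in closedBall q.1.1 ((2 : ℝ) ^ (q.1.2 : ℝ)), f y ∂μ := by
        gcongr with q
        exact ht q.1 (hut q.2)
    _ = ENNReal.ofReal (5 ^ d) * V *
          ∫⁻ y in ⋃ q ∈ u, closedBall q.1 ((2 : ℝ) ^ (q.2 : ℝ)), f y ∂μ := by
        rw [lintegral_biUnion hu (fun _ _ => measurableSet_closedBall) hdisj]
    _ ≤ _ := by
        exact mul_le_mul_right (setLIntegral_le_lintegral _ _) _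

theorem dyadicMean_add (f g : E → ℝ≥0∞) (hg : Measurable g) (k : ℤ) (x : E) :
    dyadicMean μ (fun y => f y + g y) k x = dyadicMean μ f k x + dyadicMean μ g k x := by
  unfold dyadicMean
  rw [lintegral_add_right _ hg, mul_add]

theorem dyadicMean_const (c : ℝ≥0∞) (k : ℤ) (x : E) :
    dyadicMean μ (fun _ => c) k x = μ (closedBall 0 1) * c := by
  unfold dyadicMean
  rw [setLIntegral_const, measure_closedBall_two_rpow]
  calc _ = (2 ^ (-((k : ℝ) * finrank ℝ E)) * 2 ^ ((k : ℝ) * finrank ℝ E)) *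
        (μ (closedBall (0 : E) 1) * c) := by ring
    _ = _ := by rw [← ENNReal.two_rpow_add]; simp

theorem dyadicMean_mono {f g : E → ℝ≥0∞} (h : ∀ y, f y ≤ g y) (k : ℤ) (x : E) :
    dyadicMean μ f k x ≤ dyadicMean μ g k x := by
  unfold dyadicMean
  gcongr
  exact h _

/-- Dyadic layer-cake bound: for finite nonzero `a`, the single level `k` with `2^k < a ≤ 2^(k+1)`
suffices. -/
theorem ENNReal.rpow_le_tsum_int_indicator (a : ℝ≥0∞) {r : ℝ} (hr : 0 < r) :
    a ^ r ≤ ∑' k : ℤ, {b : ℝ≥0∞ | 2 ^ (k : ℝ) < b}.indicator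
      (fun _ => (2 : ℝ≥0∞) ^ (((k : ℝ) + 1) * r)) a := by
  rcases eq_or_ne a 0 with rfl | h0
  · simp [hr]
  rcases eq_or_ne a ∞ with rfl | ht
  · have hk : ∀ k : ℕ, (k : ℝ≥0∞) ≤ ∑' k : ℤ, {b : ℝ≥0∞ | 2 ^ (k : ℝ) < b}.indicator
        (fun _ => (2 : ℝ≥0∞) ^ (((k : ℝ) + 1) * r)) ∞ := by
      intro k
      obtain ⟨m, hm⟩ : ∃ m : ℕ, (k : ℝ) / r ≤ m := exists_nat_ge _
      refine le_trans ?_ (ENNReal.le_tsum (m : ℤ))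
      rw [Set.indicator_of_mem]
      · calc (k : ℝ≥0∞) ≤ 2 ^ k := by exact_mod_cast (Nat.lt_two_pow_self (n := k)).le
          _ = 2 ^ (k : ℝ) := by simp
          _ ≤ _ := by
            refine ENNReal.rpow_le_rpow_of_exponent_le (by norm_num) ?_
            rw [div_le_iff₀ hr] at hm
            push_cast
            nlinarith
      · exact (ENNReal.two_rpow_ne_top _).lt_top
    rw [ENNReal.top_rpow_of_pos hr]
    exact (ENNReal.eq_top_of_forall_nnreal_le fun x =>
      (show (x : ℝ≥0∞) ≤ (⌈x⌉₊ : ℝ≥0∞) by exact_mod_cast Nat.le_ceil x).trans (hk _)).ge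
  obtain ⟨x, rfl⟩ := ENNReal.exists_eq_two_rpow h0 ht
  have h1 : ((⌈x⌉ - 1 : ℤ) : ℝ) < x := by
    push_cast
    linarith [Int.ceil_lt_add_one x]
  refine le_trans ?_ (ENNReal.le_tsum (⌈x⌉ - 1))
  rw [Set.indicator_of_mem]
  · rw [← ENNReal.rpow_mul]
    refine ENNReal.rpow_le_rpow_of_exponent_le (by norm_num) ?_
    push_cast
    rw [sub_add_cancel]
    exact mul_le_mul_of_nonneg_right (Int.le_ceil x) hr.le
  · exact ENNReal.rpow_lt_rpow_of_exponent_lt (by norm_num) (by norm_num) h1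

/-- The part of `f` above the height `2^(k - 1 - v)` alone makes its maximal function exceed the
height `2^k`, when the unit ball has volume `2^v`. -/
theorem measure_lt_dyadicMaximal_le [Nontrivial E] {f : E → ℝ≥0∞} {v : ℝ}
    (hv : μ (closedBall 0 1) = 2 ^ v) (k : ℝ) :
    μ {x | 2 ^ k < dyadicMaximal μ f x} ≤
      2 ^ (-(k - 1)) * (ENNReal.ofReal (5 ^ finrank ℝ E) * μ (closedBall 0 1) *
        ∫⁻ y, {b : ℝ≥0∞ | 2 ^ (k - 1 - v) < b}.indicator id (f y) ∂μ) := by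
  set g : E → ℝ≥0∞ := fun y => {b : ℝ≥0∞ | 2 ^ (k - 1 - v) < b}.indicator id (f y) with hg
  have hfg : ∀ y, f y ≤ g y + 2 ^ (k - 1 - v) := by
    intro y
    by_cases h : 2 ^ (k - 1 - v) < f y
    · simp [hg, h]
    · exact (not_lt.1 h).trans le_add_self
  have hsub : {x | 2 ^ k < dyadicMaximal μ f x} ⊆ {x | 2 ^ (k - 1) < dyadicMaximal μ g x} := by
    intro x hx
    obtain ⟨j, hj⟩ := lt_iSup_iff.1 (show 2 ^ k < ⨆ j : ℤ, dyadicMean μ f j x from hx)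
    refine lt_of_lt_of_le ?_ (dyadicMean_le_dyadicMaximal μ g j x)
    -- The mean is normalized by the radius, not by the volume, so the mean of a constant carries
    -- the factor `2^v`; the shift by `v` in the cutoff cancels it.
    have h1 : dyadicMean μ f j x ≤ dyadicMean μ g j x + 2 ^ (k - 1) := by
      refine (dyadicMean_mono μ hfg j x).trans ?_
      rw [dyadicMean_add μ _ _ measurable_const, dyadicMean_const, hv, ← ENNReal.two_rpow_add]
      exact le_of_eq (by congr 2; ring)
    have h2 : (2 : ℝ≥0∞) ^ k = 2 ^ (k - 1) + 2 ^ (k - 1) := by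
      have : k = 1 + (k - 1) := by ring
      conv_lhs => rw [this, ENNReal.two_rpow_add, ENNReal.rpow_one, two_mul]
    rw [h2] at hj
    exact lt_of_add_lt_add_right (hj.trans_le h1)
  have hw := mul_measure_lt_dyadicMaximal_le μ g (2 ^ (k - 1))
  calc μ {x | 2 ^ k < dyadicMaximal μ f x} ≤ μ {x | 2 ^ (k - 1) < dyadicMaximal μ g x} :=
        measure_mono hsub
    _ = 2 ^ (-(k - 1)) * (2 ^ (k - 1) * μ {x | 2 ^ (k - 1) < dyadicMaximal μ g x}) := by
        rw [← mul_assoc, ← ENNReal.two_rpow_add]; simp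
    _ ≤ _ := by gcongr

/-- The maximal function is bounded on `L^r` for `r > 1`. -/
theorem exists_lintegral_dyadicMaximal_rpow_le [Nontrivial E] {r : ℝ} (hr : 1 < r) :
    ∃ C : ℝ≥0∞, C ≠ ∞ ∧ ∀ f : E → ℝ≥0∞, AEMeasurable f μ →
      ∫⁻ x, dyadicMaximal μ f x ^ r ∂μ ≤ C * ∫⁻ x, f x ^ r ∂μ := by
  have hV0 : μ (closedBall (0 : E) 1) ≠ 0 := (measure_closedBall_pos μ 0 one_pos).ne'
  have hVt : μ (closedBall (0 : E) 1) ≠ ∞ := measure_closedBall_lt_top.ne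
  obtain ⟨v, hv⟩ := ENNReal.exists_eq_two_rpow hV0 hVt
  obtain ⟨C₁, -, hC₁t, hC₁⟩ := ENNReal.exists_tsum_int_min_le (sub_pos.2 hr) one_pos
  set C₀ := ENNReal.ofReal (5 ^ finrank ℝ E) * μ (closedBall (0 : E) 1) with hC₀
  have hC₀t : C₀ ≠ ∞ := ENNReal.mul_ne_top ENNReal.ofReal_ne_top hVt
  set D : ℝ≥0∞ := 2 ^ (r + 1) * C₁ * 2 ^ ((1 + v) * (r - 1)) with hD
  have hDt : D ≠ ∞ := ENNReal.mul_ne_top (ENNReal.mul_ne_top (ENNReal.two_rpow_ne_top _) hC₁t)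
    (ENNReal.two_rpow_ne_top _)
  have hr0 : 0 < r := by linarith
  have key : ∀ f : E → ℝ≥0∞, Measurable f →
      ∫⁻ x, dyadicMaximal μ f x ^ r ∂μ ≤ C₀ * D * ∫⁻ x, f x ^ r ∂μ := by
    intro f hf
    have hM := measurable_dyadicMaximal μ hf
    -- Only levels with `2^k < 2^(1+v) a` contribute, and their terms grow like `2^(k(r-1))`, so the
    -- sum is comparable to its last term because `r > 1`. Replacing the cutoff by a minimum brings
    -- this under the two-sided geometric sum.
    have hsum : ∀ a : ℝ≥0∞, ∑' k : ℤ, (2 : ℝ≥0∞) ^ (((k : ℝ) + 1) * r) *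
        (2 ^ (-((k : ℝ) - 1)) * {b : ℝ≥0∞ | 2 ^ ((k : ℝ) - 1 - v) < b}.indicator id a) ≤
        D * a ^ r := by
      intro a
      have hterm : ∀ k : ℤ, (2 : ℝ≥0∞) ^ (((k : ℝ) + 1) * r) *
          (2 ^ (-((k : ℝ) - 1)) * {b : ℝ≥0∞ | 2 ^ ((k : ℝ) - 1 - v) < b}.indicator id a) ≤
          2 ^ (r + 1) * a * min (2 ^ ((k : ℝ) * (r - 1)) * 1)
            (2 ^ (-((k : ℝ) * 1)) * (2 ^ (1 + v) * a) ^ r) := by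
        intro k
        by_cases h : 2 ^ ((k : ℝ) - 1 - v) < a
        · rw [Set.indicator_of_mem (by exact h), min_eq_left, mul_one, id]
          · rw [← mul_assoc, ← ENNReal.two_rpow_add, mul_right_comm, ← ENNReal.two_rpow_add]
            exact le_of_eq (by congr 2; ring)
          · calc (2 : ℝ≥0∞) ^ ((k : ℝ) * (r - 1)) * 1
                = 2 ^ (-((k : ℝ) * 1)) * (2 ^ (1 + v) * 2 ^ ((k : ℝ) - 1 - v)) ^ r := by
                  rw [← ENNReal.two_rpow_add, ← ENNReal.rpow_mul, ← ENNReal.two_rpow_add, mul_one]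
                  congr 1; ring
              _ ≤ _ := by gcongr
        · rw [Set.indicator_of_notMem (by exact h)]
          simp
      refine (ENNReal.tsum_le_tsum hterm).trans ?_
      rw [ENNReal.tsum_mul_left]
      refine (mul_le_mul_right (hC₁ 1 _) _).trans (le_of_eq ?_)
      rw [ENNReal.one_rpow, one_mul, ← ENNReal.rpow_mul, sub_add_cancel, mul_div_cancel₀ _ hr0.ne',
        ENNReal.mul_rpow_of_nonneg _ _ (by linarith), ← ENNReal.rpow_mul]
      have : a ^ r = a * a ^ (r - 1) := by
        conv_rhs => rw [← ENNReal.rpow_one a, ← ENNReal.rpow_mul,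
          ← ENNReal.rpow_add_of_nonneg _ _ zero_le_one (by linarith)]
        congr 1; ring
      rw [this, hD]
      ring
    calc ∫⁻ x, dyadicMaximal μ f x ^ r ∂μ
        ≤ ∫⁻ x, ∑' k : ℤ, {y | 2 ^ (k : ℝ) < dyadicMaximal μ f y}.indicator
            (fun _ => (2 : ℝ≥0∞) ^ (((k : ℝ) + 1) * r)) x ∂μ :=
          lintegral_mono fun x => ENNReal.rpow_le_tsum_int_indicator _ hr0
      _ = ∑' k : ℤ, (2 : ℝ≥0∞) ^ (((k : ℝ) + 1) * r) * μ {y | 2 ^ (k : ℝ) < dyadicMaximal μ f y} := by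
          rw [lintegral_tsum]
          · refine tsum_congr fun k => ?_
            exact lintegral_indicator_const (measurableSet_lt measurable_const hM) _
          · exact fun k => (measurable_const.indicator
              (measurableSet_lt measurable_const hM)).aemeasurable
      _ ≤ ∑' k : ℤ, (2 : ℝ≥0∞) ^ (((k : ℝ) + 1) * r) * (2 ^ (-((k : ℝ) - 1)) * (C₀ *
            ∫⁻ y, {b : ℝ≥0∞ | 2 ^ ((k : ℝ) - 1 - v) < b}.indicator id (f y) ∂μ)) := by
          gcongr with k
          exact measure_lt_dyadicMaximal_le μ hv k
      _ = C₀ * ∫⁻ y, ∑' k : ℤ, (2 : ℝ≥0∞) ^ (((k : ℝ) + 1) * r) *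
            (2 ^ (-((k : ℝ) - 1)) *
              {b : ℝ≥0∞ | 2 ^ ((k : ℝ) - 1 - v) < b}.indicator id (f y)) ∂μ := by
          have hmeas : ∀ k : ℤ, Measurable fun y =>
              {b : ℝ≥0∞ | 2 ^ ((k : ℝ) - 1 - v) < b}.indicator id (f y) := fun k =>
            (measurable_id.indicator (measurableSet_lt measurable_const measurable_id)).comp hf
          rw [lintegral_tsum fun k =>
            (((hmeas k).const_mul _).const_mul _).aemeasurable, ← ENNReal.tsum_mul_left]
          refine tsum_congr fun k => ?_
          rw [lintegral_const_mul _ ((hmeas k).const_mul _), lintegral_const_mul _ (hmeas k)]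
          ring
      _ ≤ C₀ * ∫⁻ y, D * f y ^ r ∂μ := by
          gcongr with y
          exact hsum _
      _ = C₀ * D * ∫⁻ x, f x ^ r ∂μ := by
          rw [lintegral_const_mul' _ _ hDt]
          exact (mul_assoc _ _ _).symm
  refine ⟨C₀ * D, ENNReal.mul_ne_top hC₀t hDt, fun f hf => ?_⟩
  rw [dyadicMaximal_congr_ae μ hf.ae_eq_mk]
  refine (key _ hf.measurable_mk).trans_eq ?_
  congr 1
  exact lintegral_congr_ae (hf.ae_eq_mk.symm.mono fun x hx => by simp only [hx])

end MaximalFunction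

/-! ### Convolution with dyadic dilates of a Schwartz function -/

section DyadicDilate

set_option linter.unusedSectionVars false

variable {E : Type*} [NormedAddCommGroup E] [NormedSpace ℝ E] [FiniteDimensional ℝ E]
  [MeasurableSpace E] [BorelSpace E] (μ : Measure E) [μ.IsAddHaarMeasure]

theorem Complex.enorm_ofReal_eq (a : ℝ) : ‖(a : ℂ)‖ₑ = ‖a‖ₑ := by
  rw [← ofReal_norm, Complex.norm_real, ofReal_norm]

/-- The `L¹`-normalized dilate of `K` to the scale `2^(-j)`, centred at `x`. -/
noncomputable def dyadicDilate (K : E → ℂ) (j : ℤ) (x y : E) : ℂ :=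
  ((2 : ℝ) ^ ((j : ℝ) * finrank ℝ E) : ℝ) * K ((2 : ℝ) ^ (j : ℝ) • (y - x))

theorem continuous_dyadicDilate (K : 𝓢(E, ℂ)) (j : ℤ) (x : E) :
    Continuous (dyadicDilate K j x) := by
  unfold dyadicDilate
  have := K.continuous
  fun_prop

/-- Decay of order `d + 1`, read at the smallest `k` with `‖z‖ ≤ 2^k`. The one power beyond the
dimension leaves a summable `2^(-k)` once each ball is normalized by its volume. -/
theorem SchwartzMap.exists_enorm_le_tsum_indicator (K : 𝓢(E, ℂ)) :
    ∃ C : ℝ≥0∞, C ≠ ∞ ∧ ∀ z, ‖K z‖ₑ ≤ C * ∑' k : ℕ,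
      (closedBall (0 : E) ((2 : ℝ) ^ (k : ℝ))).indicator
        (fun _ => (2 : ℝ≥0∞) ^ (-((k : ℝ) * (finrank ℝ E + 1)))) z := by
  set d := finrank ℝ E
  have hdec := SchwartzMap.one_add_le_sup_seminorm_apply (𝕜 := ℝ) (m := (d + 1, 0)) (k := d + 1)
    (n := 0) le_rfl le_rfl K
  set D : ℝ := 2 ^ (d + 1) * (Finset.Iic (d + 1, 0)).sup
    (fun m => SchwartzMap.seminorm ℝ (E := E) (F := ℂ) m.1 m.2) K
  refine ⟨ENNReal.ofReal (2 ^ (d + 1) * D), ENNReal.ofReal_ne_top, fun z => ?_⟩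
  have hz : (1 + ‖z‖) ^ (d + 1) * ‖K z‖ ≤ D := by simpa using hdec z
  have hex : ∃ k : ℕ, ‖z‖ ≤ (2 : ℝ) ^ k := by
    obtain ⟨k, hk⟩ := pow_unbounded_of_one_lt ‖z‖ (one_lt_two : (1 : ℝ) < 2)
    exact ⟨k, hk.le⟩
  classical
  set k := Nat.find hex
  have hk : ‖z‖ ≤ (2 : ℝ) ^ k := Nat.find_spec hex
  have hk' : (2 : ℝ) ^ k ≤ 2 * (1 + ‖z‖) := by
    rcases Nat.eq_zero_or_pos k with h | h
    · rw [h]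
      have := norm_nonneg z
      norm_num
      linarith
    · have h1 := Nat.find_min hex (Nat.sub_lt h one_pos)
      push Not at h1
      have h2 : (2 : ℝ) ^ k = 2 * 2 ^ (k - 1) := by
        rw [← pow_succ', Nat.sub_add_cancel h]
      rw [h2]
      linarith
  refine le_trans ?_ (mul_le_mul_right (ENNReal.le_tsum k) _)
  rw [Set.indicator_of_mem (by simpa using hk), ← ENNReal.ofReal_two_rpow,
    ← ENNReal.ofReal_mul' (by positivity), ← ofReal_norm]
  refine ENNReal.ofReal_le_ofReal ?_
  rw [Real.rpow_neg (by norm_num), ← div_eq_mul_inv, le_div_iff₀ (by positivity)]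
  have h3 : (2 : ℝ) ^ ((k : ℝ) * (d + 1)) = (2 ^ k) ^ (d + 1) := by
    rw [Real.rpow_mul (by norm_num), Real.rpow_natCast, ← Nat.cast_add_one, Real.rpow_natCast]
  rw [h3]
  calc ‖K z‖ * (2 ^ k) ^ (d + 1) ≤ ‖K z‖ * (2 * (1 + ‖z‖)) ^ (d + 1) := by gcongr
    _ = 2 ^ (d + 1) * ((1 + ‖z‖) ^ (d + 1) * ‖K z‖) := by rw [mul_pow]; ring
    _ ≤ _ := by gcongr

theorem SchwartzMap.exists_lintegral_mul_dyadicDilate_le (K : 𝓢(E, ℂ)) :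
    ∃ C : ℝ≥0∞, C ≠ ∞ ∧ ∀ f : E → ℝ≥0∞, AEMeasurable f μ → ∀ (j : ℤ) (x : E),
      ∫⁻ y, f y * ‖dyadicDilate K j x y‖ₑ ∂μ ≤
        C * ∑' k : ℕ, 2 ^ (-(k : ℝ)) * dyadicMean μ f (k - j) x := by
  obtain ⟨C, hCt, hC⟩ := K.exists_enorm_le_tsum_indicator
  refine ⟨C, hCt, fun f hf j x => ?_⟩
  set d := finrank ℝ E
  have hpt : ∀ y, f y * ‖dyadicDilate K j x y‖ₑ ≤ C * ∑' k : ℕ, 2 ^ ((j : ℝ) * d) *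
      2 ^ (-((k : ℝ) * (d + 1))) *
        (closedBall x ((2 : ℝ) ^ (((k : ℤ) - j : ℤ) : ℝ))).indicator f y := by
    intro y
    have h1 : ‖dyadicDilate K j x y‖ₑ =
        2 ^ ((j : ℝ) * d) * ‖K ((2 : ℝ) ^ (j : ℝ) • (y - x))‖ₑ := by
      unfold dyadicDilate
      rw [enorm_mul, ← ENNReal.ofReal_two_rpow, Complex.enorm_ofReal_eq,
        Real.enorm_of_nonneg (by positivity)]
    rw [h1]
    refine (mul_le_mul_right (mul_le_mul_right (hC _) _) _).trans ?_
    rw [← mul_assoc, ← mul_assoc, mul_comm _ C, mul_assoc]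
    gcongr
    rw [← ENNReal.tsum_mul_left]
    refine ENNReal.tsum_le_tsum fun k => ?_
    have hmem : (2 : ℝ) ^ (j : ℝ) • (y - x) ∈ closedBall (0 : E) ((2 : ℝ) ^ (k : ℝ)) ↔
        y ∈ closedBall x ((2 : ℝ) ^ (((k : ℤ) - j : ℤ) : ℝ)) := by
      rw [mem_closedBall_zero_iff, norm_smul, mem_closedBall, dist_eq_norm, Int.cast_sub,
        Real.rpow_sub (by norm_num), le_div_iff₀ (by positivity),
        Real.norm_of_nonneg (by positivity), mul_comm]
      simp
    by_cases h : y ∈ closedBall x ((2 : ℝ) ^ (((k : ℤ) - j : ℤ) : ℝ))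
    · rw [Set.indicator_of_mem (hmem.2 h), Set.indicator_of_mem h]
      exact le_of_eq (by ring)
    · rw [Set.indicator_of_notMem (fun h' => h (hmem.1 h'))]
      simp
  refine (lintegral_mono hpt).trans ?_
  rw [lintegral_const_mul' _ _ hCt]
  gcongr
  rw [lintegral_tsum fun k => (hf.indicator measurableSet_closedBall).const_mul _]
  refine le_of_eq (tsum_congr fun k => ?_)
  rw [lintegral_const_mul' _ _
      (ENNReal.mul_ne_top (ENNReal.two_rpow_ne_top _) (ENNReal.two_rpow_ne_top _)),
    lintegral_indicator measurableSet_closedBall, dyadicMean, ← mul_assoc,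
    ← ENNReal.two_rpow_add, ← ENNReal.two_rpow_add]
  congr 2
  push_cast
  ring

theorem ENNReal.tsum_nat_two_rpow_neg_ne_top {a : ℝ} (ha : 0 < a) :
    ∑' k : ℕ, (2 : ℝ≥0∞) ^ (-((k : ℝ) * a)) ≠ ∞ := by
  have h : ∀ k : ℕ, (2 : ℝ≥0∞) ^ (-((k : ℝ) * a)) = (2 ^ (-a)) ^ k := by
    intro k
    rw [← ENNReal.rpow_mul_natCast]
    congr 1
    ring
  simp_rw [h]
  rw [ENNReal.tsum_geometric]
  refine ENNReal.inv_ne_top.2 (tsub_pos_of_lt ?_).ne'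
  exact ENNReal.rpow_lt_one_of_one_lt_of_neg (by norm_num) (by linarith)

theorem SchwartzMap.exists_lintegral_mul_dyadicDilate_le_dyadicMaximal (K : 𝓢(E, ℂ)) :
    ∃ C : ℝ≥0∞, C ≠ ∞ ∧ ∀ f : E → ℝ≥0∞, AEMeasurable f μ → ∀ (j : ℤ) (x : E),
      ∫⁻ y, f y * ‖dyadicDilate K j x y‖ₑ ∂μ ≤ C * dyadicMaximal μ f x := by
  obtain ⟨C, hCt, hC⟩ := K.exists_lintegral_mul_dyadicDilate_le μ
  refine ⟨C * ∑' k : ℕ, (2 : ℝ≥0∞) ^ (-((k : ℝ) * 1)),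
    ENNReal.mul_ne_top hCt (ENNReal.tsum_nat_two_rpow_neg_ne_top one_pos), fun f hf j x => ?_⟩
  refine (hC f hf j x).trans ?_
  rw [mul_assoc, ← ENNReal.tsum_mul_right]
  refine mul_le_mul_right (ENNReal.tsum_le_tsum fun k => ?_) C
  rw [mul_one]
  gcongr
  exact dyadicMean_le_dyadicMaximal μ f _ x

/-- Hölder's inequality on the ball: the volume to the power `1 - 1/p`, against the normalization,
leaves `2^(-kd/p)`. -/
theorem dyadicMean_enorm_le {p : ℝ} (hp : 1 ≤ p) {v : E → ℝ} (hv : AEStronglyMeasurable v μ)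
    (k : ℤ) (x : E) :
    dyadicMean μ (fun y => ‖v y‖ₑ) k x ≤ μ (closedBall 0 1) ^ (1 - 1 / p) *
      (2 ^ (-((k : ℝ) * (finrank ℝ E / p))) * eLpNorm v (ENNReal.ofReal p) μ) := by
  have h1 := eLpNorm_le_eLpNorm_mul_rpow_measure_univ (μ := μ.restrict (closedBall x (2 ^ (k : ℝ))))
    (p := 1) (q := ENNReal.ofReal p) (by simpa using hp) hv.restrict
  rw [eLpNorm_one_eq_lintegral_enorm, Measure.restrict_apply_univ, measure_closedBall_two_rpow,
    ENNReal.toReal_ofReal (by linarith), ENNReal.toReal_one, div_one] at h1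
  have hp1 : 0 ≤ 1 - 1 / p := by
    rw [sub_nonneg, div_le_one (by linarith)]
    exact hp
  rw [ENNReal.mul_rpow_of_nonneg _ _ hp1, ← ENNReal.rpow_mul] at h1
  unfold dyadicMean
  refine (mul_le_mul_right h1 _).trans ?_
  calc _ ≤ 2 ^ (-((k : ℝ) * finrank ℝ E)) * (eLpNorm v (ENNReal.ofReal p) μ *
        (2 ^ ((k : ℝ) * finrank ℝ E * (1 - 1 / p)) * μ (closedBall 0 1) ^ (1 - 1 / p))) := by
        gcongr
        exact Measure.restrict_le_self
    _ = μ (closedBall 0 1) ^ (1 - 1 / p) * (2 ^ (-((k : ℝ) * finrank ℝ E)) *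
        2 ^ ((k : ℝ) * finrank ℝ E * (1 - 1 / p)) * eLpNorm v (ENNReal.ofReal p) μ) := by ring
    _ = _ := by
        rw [← ENNReal.two_rpow_add]
        congr 3
        ring

/-- Bernstein's inequality. The mean at scale `k - j` contributes `2^((j-k)d/p)`, whose part in `k`
is at most `1`. -/
theorem SchwartzMap.exists_lintegral_mul_dyadicDilate_le_eLpNorm (K : 𝓢(E, ℂ)) {p : ℝ}
    (hp : 1 ≤ p) :
    ∃ C : ℝ≥0∞, C ≠ ∞ ∧ ∀ v : E → ℝ, AEStronglyMeasurable v μ → ∀ (j : ℤ) (x : E),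
      ∫⁻ y, ‖v y‖ₑ * ‖dyadicDilate K j x y‖ₑ ∂μ ≤
        C * (2 ^ ((j : ℝ) * (finrank ℝ E / p)) * eLpNorm v (ENNReal.ofReal p) μ) := by
  obtain ⟨C, hCt, hC⟩ := K.exists_lintegral_mul_dyadicDilate_le μ
  set V := μ (closedBall (0 : E) 1) with hV
  have hVt : V ≠ ∞ := measure_closedBall_lt_top.ne
  have hp1 : 0 ≤ 1 - 1 / p := by
    rw [sub_nonneg, div_le_one (by linarith)]
    exact hp
  refine ⟨C * ((∑' k : ℕ, (2 : ℝ≥0∞) ^ (-((k : ℝ) * 1))) * V ^ (1 - 1 / p)),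
    ENNReal.mul_ne_top hCt (ENNReal.mul_ne_top (ENNReal.tsum_nat_two_rpow_neg_ne_top one_pos)
      (ENNReal.rpow_ne_top_of_nonneg hp1 hVt)), fun v hv j x => ?_⟩
  refine (hC _ hv.enorm j x).trans ?_
  rw [mul_assoc, mul_assoc]
  gcongr C * ?_
  rw [← ENNReal.tsum_mul_right]
  refine ENNReal.tsum_le_tsum fun k => ?_
  rw [mul_one]
  gcongr 2 ^ (-(k : ℝ)) * ?_
  refine (dyadicMean_enorm_le μ hp hv _ x).trans ?_
  gcongr
  · norm_num
  · have : 0 ≤ (k : ℝ) * (finrank ℝ E / p) := by positivity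
    push_cast
    linarith

theorem SchwartzMap.integrable_mul_dyadicDilate (K : 𝓢(E, ℂ)) {p : ℝ} (hp : 1 ≤ p) {v : E → ℝ}
    (hv : MemLp v (ENNReal.ofReal p) μ) (j : ℤ) (x : E) :
    Integrable (fun y => (v y : ℂ) * dyadicDilate K j x y) μ := by
  obtain ⟨C, hCt, hC⟩ := K.exists_lintegral_mul_dyadicDilate_le_eLpNorm μ hp
  refine ⟨(Complex.continuous_ofReal.comp_aestronglyMeasurable hv.1).mul
    (continuous_dyadicDilate K j x).aestronglyMeasurable, ?_⟩
  rw [hasFiniteIntegral_iff_enorm]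
  simp_rw [enorm_mul, Complex.enorm_ofReal_eq]
  refine (hC v hv.1 j x).trans_lt (ENNReal.mul_ne_top hCt (ENNReal.mul_ne_top
    (ENNReal.two_rpow_ne_top _) hv.2.ne)).lt_top

theorem enorm_integral_mul_dyadicDilate_le (K : E → ℂ) (v : E → ℝ) (j : ℤ) (x : E) :
    ‖∫ y, (v y : ℂ) * dyadicDilate K j x y ∂μ‖ₑ ≤ ∫⁻ y, ‖v y‖ₑ * ‖dyadicDilate K j x y‖ₑ ∂μ := by
  refine (enorm_integral_le_lintegral_enorm _).trans_eq ?_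
  simp_rw [enorm_mul, Complex.enorm_ofReal_eq]

/-- The low frequencies of an `L^p` function vanish in the limit, since `p` is finite; hence the
Littlewood–Paley sum recovers `v` with no polynomial remainder. -/
theorem SchwartzMap.tendsto_integral_mul_dyadicDilate_neg [Nontrivial E] (K : 𝓢(E, ℂ)) {p : ℝ}
    (hp : 1 ≤ p) {v : E → ℝ} (hv : MemLp v (ENNReal.ofReal p) μ) (x : E) :
    Tendsto (fun n : ℕ => ∫ y, (v y : ℂ) * dyadicDilate K (-n) x y ∂μ) atTop (𝓝 0) := by
  obtain ⟨C, hCt, hC⟩ := K.exists_lintegral_mul_dyadicDilate_le_eLpNorm μ hp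
  rw [tendsto_zero_iff_enorm_tendsto_zero]
  have hd : (0 : ℝ) < finrank ℝ E := by exact_mod_cast finrank_pos
  have ha : 0 < finrank ℝ E / p := div_pos hd (by linarith)
  have hlim : Tendsto (fun n : ℕ => C * ((2 : ℝ≥0∞) ^ (-((n : ℝ) * (finrank ℝ E / p))) *
      eLpNorm v (ENNReal.ofReal p) μ)) atTop (𝓝 0) := by
    have h0 := ENNReal.tendsto_atTop_zero_of_tsum_ne_top (ENNReal.tsum_nat_two_rpow_neg_ne_top ha)
    have h1 := ENNReal.Tendsto.const_mul (a := C)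
      (ENNReal.Tendsto.mul_const (b := eLpNorm v (ENNReal.ofReal p) μ) h0 (Or.inr hv.2.ne))
      (Or.inr hCt)
    simpa using h1
  refine tendsto_of_tendsto_of_tendsto_of_le_of_le tendsto_const_nhds hlim (fun _ => zero_le)
    fun n => ?_
  refine (enorm_integral_mul_dyadicDilate_le μ K v _ x).trans ((hC v hv.1 _ x).trans_eq ?_)
  push_cast
  rw [neg_mul]

theorem integral_dyadicDilate (K : E → ℂ) (j : ℤ) (x : E) :
    ∫ y, dyadicDilate K j x y ∂μ = ∫ y, K y ∂μ := by
  unfold dyadicDilate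
  rw [integral_const_mul, integral_sub_right_eq_self fun y => K ((2 : ℝ) ^ (j : ℝ) • y),
    Measure.integral_comp_smul_of_nonneg μ K _ (hR := by positivity), Complex.real_smul,
    ← mul_assoc, ← Complex.ofReal_mul, ← Real.rpow_mul_natCast (by norm_num),
    mul_inv_cancel₀ (by positivity), Complex.ofReal_one, one_mul]

/-- At almost every point, the means of `|v - v x|` over small balls around `x` tend to zero. -/
theorem ae_tendsto_dyadicMean_enorm_sub {v : E → ℝ} (hv : LocallyIntegrable v μ) :
    ∀ᵐ x ∂μ, Tendsto (fun k : ℤ => dyadicMean μ (fun y => ‖v y - v x‖ₑ) k x) atBot (𝓝 0) := by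
  have hV0 : μ (closedBall (0 : E) 1) ≠ 0 := (measure_closedBall_pos μ 0 one_pos).ne'
  have hVt : μ (closedBall (0 : E) 1) ≠ ∞ := measure_closedBall_lt_top.ne
  filter_upwards [(Besicovitch.vitaliFamily μ).ae_tendsto_lintegral_enorm_sub_div hv] with x hx
  have hr : Tendsto (fun k : ℤ => (2 : ℝ) ^ (k : ℝ)) atBot (𝓝[>] 0) := by
    refine tendsto_nhdsWithin_iff.2 ⟨?_, Eventually.of_forall fun k => by
      show (0 : ℝ) < _
      positivity⟩
    exact (tendsto_rpow_atBot_of_base_gt_one 2 one_lt_two).comp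
      (tendsto_intCast_atBot_iff.2 tendsto_id)
  have h := ENNReal.Tendsto.const_mul (a := μ (closedBall (0 : E) 1))
    (hx.comp ((Besicovitch.tendsto_filterAt μ x).comp hr)) (Or.inr hVt)
  rw [mul_zero] at h
  refine h.congr fun k => ?_
  simp only [Function.comp_apply]
  rw [measure_closedBall_two_rpow, dyadicMean, ENNReal.div_eq_inv_mul,
    ENNReal.mul_inv (Or.inl (ENNReal.two_rpow_ne_zero _)) (Or.inl (ENNReal.two_rpow_ne_top _)),
    ← ENNReal.rpow_neg, ← mul_assoc, mul_left_comm, ENNReal.mul_inv_cancel hV0 hVt, mul_one]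

/-- Approximate identity at Lebesgue points: the error is at most `∑ₖ 2^(-k)` times the mean of `|v
- v x|` at scale `k - n`, and dominated convergence over `k` applies. -/
theorem SchwartzMap.ae_tendsto_integral_mul_dyadicDilate (K : 𝓢(E, ℂ)) {p : ℝ}
    (hp : 1 ≤ p) {v : E → ℝ} (hv : MemLp v (ENNReal.ofReal p) μ) :
    ∀ᵐ x ∂μ, Tendsto (fun n : ℕ => ∫ y, (v y : ℂ) * dyadicDilate K n x y ∂μ) atTop
      (𝓝 (v x * ∫ y, K y ∂μ)) := by
  obtain ⟨C, hCt, hC⟩ := K.exists_lintegral_mul_dyadicDilate_le μ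
  have hVt : μ (closedBall (0 : E) 1) ≠ ∞ := measure_closedBall_lt_top.ne
  have hp1 : 0 ≤ 1 - 1 / p := by
    rw [sub_nonneg, div_le_one (by linarith)]
    exact hp
  have hloc : LocallyIntegrable v μ := hv.locallyIntegrable (by simpa using hp)
  filter_upwards [ae_tendsto_dyadicMean_enorm_sub μ hloc] with x hx
  set g : E → ℝ≥0∞ := fun y => ‖v y - v x‖ₑ with hg
  have hgm : AEMeasurable g μ := (hv.1.sub aestronglyMeasurable_const).enorm
  -- The dominating constant: the Lebesgue point property bounds the means at small scales, Hölder's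
  -- inequality those at large scales.
  obtain ⟨D, hDt, hD⟩ : ∃ D : ℝ≥0∞, D ≠ ∞ ∧ ∀ k : ℤ, dyadicMean μ g k x ≤ D := by
    obtain ⟨k₀, hk₀⟩ := (eventually_atBot.1 (hx.eventually_lt_const (zero_lt_one)))
    refine ⟨1 + (μ (closedBall 0 1) ^ (1 - 1 / p) *
      (2 ^ (-((k₀ : ℝ) * (finrank ℝ E / p))) * eLpNorm v (ENNReal.ofReal p) μ) +
        μ (closedBall 0 1) * ‖v x‖ₑ), ?_, fun k => ?_⟩
    · refine ENNReal.add_ne_top.2 ⟨by simp, ENNReal.add_ne_top.2 ⟨?_, ?_⟩⟩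
      · exact ENNReal.mul_ne_top (ENNReal.rpow_ne_top_of_nonneg hp1 hVt)
          (ENNReal.mul_ne_top (ENNReal.two_rpow_ne_top _) hv.2.ne)
      · exact ENNReal.mul_ne_top hVt enorm_ne_top
    · rcases le_total k k₀ with h | h
      · exact (hk₀ k h).le.trans le_self_add
      · refine le_trans ?_ le_add_self
        have h1 : dyadicMean μ g k x ≤ dyadicMean μ (fun y => ‖v y‖ₑ + ‖v x‖ₑ) k x :=
          dyadicMean_mono μ (fun y => enorm_sub_le) k x
        refine h1.trans ?_
        rw [dyadicMean_add μ _ _ measurable_const, dyadicMean_const]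
        gcongr
        refine (dyadicMean_enorm_le μ hp hv.1 k x).trans ?_
        gcongr
        · norm_num
  have hlim : Tendsto (fun n : ℕ => C * ∑' k : ℕ, 2 ^ (-(k : ℝ)) * dyadicMean μ g (k - (n : ℤ)) x)
      atTop (𝓝 0) := by
    have h0 : Tendsto (fun n : ℕ => ∑' k : ℕ, 2 ^ (-(k : ℝ)) * dyadicMean μ g (k - (n : ℤ)) x)
        atTop (𝓝 0) := by
      have h1 := tendsto_lintegral_of_dominated_convergence (μ := Measure.count)
        (F := fun (n k : ℕ) => 2 ^ (-(k : ℝ)) * dyadicMean μ g (k - (n : ℤ)) x) (f := fun _ => 0)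
        (fun k => 2 ^ (-(k : ℝ)) * D) (fun _ => measurable_of_countable _)
        (fun n => Eventually.of_forall fun k => by
          dsimp only
          gcongr
          exact hD _)
        (by
          rw [lintegral_count, ENNReal.tsum_mul_right]
          refine ENNReal.mul_ne_top ?_ hDt
          simpa using ENNReal.tsum_nat_two_rpow_neg_ne_top one_pos)
        (Eventually.of_forall fun k => by
          have h2 : Tendsto (fun n : ℕ => (k : ℤ) - (n : ℤ)) atTop atBot :=
            tendsto_atBot_add_const_left _ _
              (tendsto_neg_atTop_atBot.comp tendsto_natCast_atTop_atTop)
          have h3 := ENNReal.Tendsto.const_mul (a := 2 ^ (-(k : ℝ))) (hx.comp h2)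
            (Or.inr (ENNReal.two_rpow_ne_top _))
          simpa using h3)
      simpa [lintegral_count] using h1
    simpa using ENNReal.Tendsto.const_mul (a := C) h0 (Or.inr hCt)
  rw [tendsto_iff_edist_tendsto_0]
  refine tendsto_of_tendsto_of_tendsto_of_le_of_le tendsto_const_nhds hlim (fun _ => zero_le)
    fun n => ?_
  have hKint : Integrable (dyadicDilate K n x) μ := by
    unfold dyadicDilate
    refine Integrable.const_mul ?_ _
    have h1 : Integrable (fun y => K ((2 : ℝ) ^ ((n : ℤ) : ℝ) • y)) μ :=
      (K.integrable (μ := μ)).comp_smul (by positivity)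
    exact h1.comp_sub_right x
  have heq : (∫ y, (v y : ℂ) * dyadicDilate K n x y ∂μ) - v x * ∫ y, K y ∂μ =
      ∫ y, ((v y - v x : ℝ) : ℂ) * dyadicDilate K n x y ∂μ := by
    rw [← integral_dyadicDilate μ K n x, ← integral_const_mul,
      ← integral_sub (K.integrable_mul_dyadicDilate μ hp hv _ x) (hKint.const_mul _)]
    congr 1
    ext y
    push_cast
    ring
  dsimp only
  rw [edist_eq_enorm_sub, heq]
  exact (enorm_integral_mul_dyadicDilate_le μ K _ _ x).trans (hC g hgm n x)

end DyadicDilate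

/-! ### Littlewood–Paley kernels -/

section Kernels

open scoped RealInnerProductSpace ContDiff

/-- On the Fourier side, dilating and recentring a kernel means rescaling and modulating its symbol.
This exhibits the dilates as test functions for the distributional identity. -/
theorem fourierInv_fourierChar_smul_comp_smul {E : Type*} [NormedAddCommGroup E]
    [InnerProductSpace ℝ E] [FiniteDimensional ℝ E] [MeasurableSpace E] [BorelSpace E]
    (g : E → ℂ) (j : ℤ) (x y : E) :
    𝓕⁻ (fun η : E => 𝐞 (-⟪η, x⟫) • g ((2 : ℝ) ^ (-(j : ℝ)) • η)) y =
      dyadicDilate (𝓕⁻ g) j x y := by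
  have h : ∀ η : E, 𝐞 ⟪η, y⟫ • 𝐞 (-⟪η, x⟫) • g ((2 : ℝ) ^ (-(j : ℝ)) • η) =
      (fun ξ : E => 𝐞 ⟪ξ, (2 : ℝ) ^ (j : ℝ) • (y - x)⟫ • g ξ) ((2 : ℝ) ^ (-(j : ℝ)) • η) := by
    intro η
    simp only
    rw [smul_smul, ← AddChar.map_add_eq_mul, real_inner_smul_left, real_inner_smul_right,
      ← mul_assoc, ← Real.rpow_add (by norm_num), neg_add_cancel, Real.rpow_zero, one_mul,
      inner_sub_right, sub_eq_add_neg]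
  rw [Real.fourierInv_eq]
  rw [integral_congr_ae (Eventually.of_forall h),
    Measure.integral_comp_smul_of_nonneg _ (fun ξ : E => 𝐞 ⟪ξ, (2 : ℝ) ^ (j : ℝ) • (y - x)⟫ • g ξ)
      _ (hR := by positivity), dyadicDilate, Real.fourierInv_eq, Complex.real_smul]
  congr 2
  rw [← Real.rpow_mul_natCast (by norm_num), ← Real.rpow_neg (by norm_num)]
  congr 1
  ring

variable {N : ℕ}

theorem dyadicDilate_const_mul {E : Type*} [NormedAddCommGroup E] [NormedSpace ℝ E] (c : ℂ)
    (K : E → ℂ) (j : ℤ) (x y : E) :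
    dyadicDilate (fun z => c * K z) j x y = c * dyadicDilate K j x y := by
  unfold dyadicDilate
  ring

/-- If the symbol of `K` is `(2π|η|)^γ` times that of `L`, then the convolutions of `v` with the
dilates of `K` are those of `(-Δ)^(γ/2) v` with the dilates of `L`. -/
theorem IsFracLaplacian.integral_mul_dyadicDilate {γ : ℝ} {v w : EuclideanSpace ℝ (Fin N) → ℝ}
    (hvw : IsFracLaplacian γ v w) {g h : EuclideanSpace ℝ (Fin N) → ℂ} (hg : HasCompactSupport g)
    (hg' : ContDiff ℝ ∞ g)
    (hgh : ∀ η, h η = (((2 * Real.pi * ‖η‖) ^ γ : ℝ) : ℂ) * g η) (j : ℤ)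
    (x : EuclideanSpace ℝ (Fin N)) :
    (((2 : ℝ) ^ ((j : ℝ) * γ) : ℝ) : ℂ) * ∫ y, (v y : ℂ) * dyadicDilate (𝓕⁻ h) j x y =
      ∫ y, (w y : ℂ) * dyadicDilate (𝓕⁻ g) j x y := by
  set G : EuclideanSpace ℝ (Fin N) → ℂ := fun η => 𝐞 (-⟪η, x⟫) • g ((2 : ℝ) ^ (-(j : ℝ)) • η)
    with hG
  have hGc : HasCompactSupport G := by
    have h1 : HasCompactSupport fun η => g ((2 : ℝ) ^ (-(j : ℝ)) • η) :=
      hg.comp_smul (by positivity)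
    exact h1.mono fun η hη hη' => hη (by simp only at hη'; simp only [hG]; rw [hη', smul_zero])
  have hGs : ContDiff ℝ ∞ G := by
    simp only [hG, Circle.smul_def, Real.fourierChar_apply, smul_eq_mul]
    refine ContDiff.mul ?_ (hg'.comp (contDiff_const_smul _))
    refine ContDiff.cexp (ContDiff.mul (Complex.ofRealCLM.contDiff.comp ?_) contDiff_const)
    exact contDiff_const.mul (contDiff_id.inner ℝ contDiff_const).neg
  set S : 𝓢(EuclideanSpace ℝ (Fin N), ℂ) := hGc.toSchwartzMap hGs
  have hφ : ∀ y, (𝓕⁻ S) y = dyadicDilate (𝓕⁻ g) j x y := by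
    intro y
    rw [SchwartzMap.fourierInv_coe]
    exact fourierInv_fourierChar_smul_comp_smul g j x y
  have hφ' : ∀ η, 𝓕 ((𝓕⁻ S : 𝓢(EuclideanSpace ℝ (Fin N), ℂ)) :
      EuclideanSpace ℝ (Fin N) → ℂ) η = G η := by
    intro η
    rw [← SchwartzMap.fourier_coe, FourierTransform.fourier_fourierInv_eq]
    rfl
  have hlap : ∀ y, schwartzFracLaplacian γ (𝓕⁻ S) y =
      (((2 : ℝ) ^ ((j : ℝ) * γ) : ℝ) : ℂ) * dyadicDilate (𝓕⁻ h) j x y := by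
    intro y
    unfold schwartzFracLaplacian
    have h1 : (fun η : EuclideanSpace ℝ (Fin N) => (((2 * Real.pi * ‖η‖) ^ γ : ℝ) : ℂ) *
        𝓕 ((𝓕⁻ S : 𝓢(EuclideanSpace ℝ (Fin N), ℂ)) : EuclideanSpace ℝ (Fin N) → ℂ) η) =
        fun η => 𝐞 (-⟪η, x⟫) • ((fun ξ => (((2 : ℝ) ^ ((j : ℝ) * γ) : ℝ) : ℂ) * h ξ)
          ((2 : ℝ) ^ (-(j : ℝ)) • η)) := by
      ext η
      rw [hφ', hG]
      simp only
      rw [hgh, norm_smul, Real.norm_of_nonneg (by positivity), Circle.smul_def, Circle.smul_def,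
        smul_eq_mul, smul_eq_mul, ← mul_assoc (((2 : ℝ) ^ ((j : ℝ) * γ) : ℝ) : ℂ),
        ← Complex.ofReal_mul]
      -- Homogeneity of the symbol is the source of the factor `2^(jγ)`.
      have h2 : (2 : ℝ) ^ ((j : ℝ) * γ) * (2 * Real.pi * (2 ^ (-(j : ℝ)) * ‖η‖)) ^ γ =
          (2 * Real.pi * ‖η‖) ^ γ := by
        rw [Real.rpow_mul (by norm_num), ← Real.mul_rpow (by positivity) (by positivity)]
        congr 1
        rw [Real.rpow_neg (by norm_num)]
        field_simp
      rw [h2]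
      ring
    rw [h1, ← dyadicDilate_const_mul]
    refine (fourierInv_fourierChar_smul_comp_smul
      (fun ξ => (((2 : ℝ) ^ ((j : ℝ) * γ) : ℝ) : ℂ) * h ξ) j x y).trans ?_
    congr 1
    ext z
    rw [Real.fourierInv_eq, Real.fourierInv_eq, ← integral_const_mul]
    congr 1
    ext η
    rw [Circle.smul_def, Circle.smul_def, smul_eq_mul, smul_eq_mul]
    ring
  have hmain := hvw (𝓕⁻ S)
  simp_rw [hφ, hlap] at hmain
  rw [← hmain, ← integral_const_mul]
  congr 1
  ext y
  ring

theorem dyadicDilate_dyadicDilate {E : Type*} [NormedAddCommGroup E] [NormedSpace ℝ E]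
    (K : E → ℂ) (i j : ℤ) (x y : E) :
    dyadicDilate (dyadicDilate K i 0) j x y = dyadicDilate K (j + i) x y := by
  unfold dyadicDilate
  rw [← mul_assoc, ← Complex.ofReal_mul, ← Real.rpow_add (by norm_num), sub_zero, smul_smul,
    ← Real.rpow_add (by norm_num)]
  push_cast
  rw [add_comm (i : ℝ) (j : ℝ), add_mul]

/-- Here `θ` has a bump `X` equal to `1` near the origin as its symbol, and `ψ` has the symbol
`X(η/2) - X(η)`. The latter vanishes on the unit ball, so dividing it by `(2π|η|)^γ` keeps it smooth
and defines `κ`. -/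
theorem exists_littlewoodPaley_kernels (N : ℕ) (γ : ℝ) :
    ∃ θ ψ κ : 𝓢(EuclideanSpace ℝ (Fin N), ℂ), ∫ y, θ y = 1 ∧
      (∀ (j : ℤ) x y, dyadicDilate ψ j x y = dyadicDilate θ (j + 1) x y - dyadicDilate θ j x y) ∧
      ∀ v w : EuclideanSpace ℝ (Fin N) → ℝ, IsFracLaplacian γ v w → ∀ (j : ℤ) x,
        (((2 : ℝ) ^ ((j : ℝ) * γ) : ℝ) : ℂ) * ∫ y, (v y : ℂ) * dyadicDilate ψ j x y =
          ∫ y, (w y : ℂ) * dyadicDilate κ j x y := by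
  let b : ContDiffBump (0 : EuclideanSpace ℝ (Fin N)) := ⟨1, 2, by norm_num, by norm_num⟩
  let X : EuclideanSpace ℝ (Fin N) → ℂ := fun η => (b η : ℂ)
  have hXs : ContDiff ℝ ∞ X := Complex.ofRealCLM.contDiff.comp b.contDiff
  have hXc : HasCompactSupport X :=
    b.hasCompactSupport.comp_left (g := ((↑) : ℝ → ℂ)) Complex.ofReal_zero
  have hX1 : ∀ η, ‖η‖ ≤ 1 → X η = 1 := by
    intro η hη
    simp only [X]
    rw [b.one_of_mem_closedBall (by simpa using hη), Complex.ofReal_one]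
  let Y : EuclideanSpace ℝ (Fin N) → ℂ := fun η => X ((2 : ℝ) ^ (-((1 : ℤ) : ℝ)) • η)
  have hYs : ContDiff ℝ ∞ Y := hXs.comp (contDiff_const_smul _)
  have hYc : HasCompactSupport Y := hXc.comp_smul (by positivity)
  let Z : EuclideanSpace ℝ (Fin N) → ℂ := fun η => Y η - X η
  have hZs : ContDiff ℝ ∞ Z := hYs.sub hXs
  have hZc : HasCompactSupport Z := hYc.sub hXc
  have hZ0 : ∀ η, ‖η‖ ≤ 1 → Z η = 0 := by
    intro η hη
    have h1 : ‖(2 : ℝ) ^ (-((1 : ℤ) : ℝ)) • η‖ ≤ 1 := by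
      rw [norm_smul, Int.cast_one, Real.rpow_neg_one, norm_inv, Real.norm_two]
      linarith
    simp only [Z, Y]
    rw [hX1 _ hη, hX1 _ h1, sub_self]
  let G : EuclideanSpace ℝ (Fin N) → ℂ := fun η => (((2 * Real.pi * ‖η‖) ^ (-γ) : ℝ) : ℂ) * Z η
  have hGc : HasCompactSupport G := hZc.mul_left
  have hGs : ContDiff ℝ ∞ G := by
    rw [contDiff_iff_contDiffAt]
    intro η
    rcases eq_or_ne η 0 with rfl | hη
    · refine (contDiffAt_const (c := (0 : ℂ))).congr_of_eventuallyEq ?_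
      filter_upwards [closedBall_mem_nhds (0 : EuclideanSpace ℝ (Fin N)) one_pos] with ξ hξ
      simp only [G]
      rw [hZ0 ξ (by simpa using hξ), mul_zero]
    · refine ContDiffAt.mul ?_ hZs.contDiffAt
      refine Complex.ofRealCLM.contDiff.contDiffAt.comp η ?_
      refine ContDiffAt.rpow_const_of_ne (contDiffAt_const.mul (contDiffAt_norm ℝ hη)) ?_
      have := norm_pos_iff.2 hη
      positivity
  have hGZ : ∀ η, Z η = (((2 * Real.pi * ‖η‖) ^ γ : ℝ) : ℂ) * G η := by
    intro η
    rcases eq_or_ne η 0 with rfl | hη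
    · simp only [G]
      rw [hZ0 0 (by simp), mul_zero, mul_zero]
    · have h0 := norm_pos_iff.2 hη
      have h1 : (0 : ℝ) < 2 * Real.pi * ‖η‖ := by positivity
      simp only [G]
      rw [← mul_assoc, ← Complex.ofReal_mul, ← Real.rpow_add h1, add_neg_cancel, Real.rpow_zero,
        Complex.ofReal_one, one_mul]
  let Xs := hXc.toSchwartzMap hXs
  let Ys := hYc.toSchwartzMap hYs
  let Gs := hGc.toSchwartzMap hGs
  let Zs := hZc.toSchwartzMap hZs
  have hYZX : Ys = Zs + Xs := by
    ext η
    exact (sub_add_cancel _ _).symm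
  have hθ : ((𝓕⁻ Xs : 𝓢(EuclideanSpace ℝ (Fin N), ℂ)) : EuclideanSpace ℝ (Fin N) → ℂ) = 𝓕⁻ X :=
    SchwartzMap.fourierInv_coe _
  have hψ : ((𝓕⁻ Zs : 𝓢(EuclideanSpace ℝ (Fin N), ℂ)) : EuclideanSpace ℝ (Fin N) → ℂ) = 𝓕⁻ Z :=
    SchwartzMap.fourierInv_coe _
  have hκ : ((𝓕⁻ Gs : 𝓢(EuclideanSpace ℝ (Fin N), ℂ)) : EuclideanSpace ℝ (Fin N) → ℂ) = 𝓕⁻ G :=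
    SchwartzMap.fourierInv_coe _
  refine ⟨𝓕⁻ Xs, 𝓕⁻ Zs, 𝓕⁻ Gs, ?_, ?_, ?_⟩
  · have h1 : 𝓕 ((𝓕⁻ Xs : 𝓢(EuclideanSpace ℝ (Fin N), ℂ)) :
        EuclideanSpace ℝ (Fin N) → ℂ) 0 = X 0 := by
      rw [← SchwartzMap.fourier_coe, FourierTransform.fourier_fourierInv_eq]
      rfl
    rw [hX1 0 (by simp), Real.fourier_eq] at h1
    simpa using h1
  · intro j x y
    -- The dyadic difference at scale `0`; dilation by `2^j` gives every other scale.
    have h1 : ∀ z, (𝓕⁻ Zs : 𝓢(EuclideanSpace ℝ (Fin N), ℂ)) z =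
        dyadicDilate (𝓕⁻ Xs : 𝓢(EuclideanSpace ℝ (Fin N), ℂ)) 1 0 z -
          (𝓕⁻ Xs : 𝓢(EuclideanSpace ℝ (Fin N), ℂ)) z := by
      intro z
      rw [eq_sub_iff_add_eq, ← _root_.add_apply, ← FourierTransform.fourierInv_add, ← hYZX]
      rw [SchwartzMap.fourierInv_coe, hθ, ← fourierInv_fourierChar_smul_comp_smul]
      refine congrFun (congrArg _ (funext fun η => ?_)) z
      simp [Ys, Y]
    rw [← dyadicDilate_dyadicDilate]
    unfold dyadicDilate at h1 ⊢
    rw [h1]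
    ring
  · intro v w hvw j x
    rw [hψ, hκ]
    exact hvw.integral_mul_dyadicDilate hGc hGs hGZ j x

end Kernels

/-! ### Pointwise and Lebesgue norm estimates -/

section Estimates

/-- Telescoping from `-n` to `n`; only this inequality is needed, not convergence of the series. -/
theorem enorm_le_tsum_int_of_tendsto {P : ℤ → ℂ} {z : ℂ}
    (htop : Tendsto (fun n : ℕ => P n) atTop (𝓝 z))
    (hbot : Tendsto (fun n : ℕ => P (-n)) atTop (𝓝 0)) :
    ‖z‖ₑ ≤ ∑' j : ℤ, ‖P (j + 1) - P j‖ₑ := by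
  have hlim : Tendsto (fun n : ℕ => ‖P n - P (-n)‖ₑ) atTop (𝓝 ‖z‖ₑ) := by
    have := (htop.sub hbot).enorm
    rwa [sub_zero] at this
  refine le_of_tendsto' hlim fun n => ?_
  have htel : ∀ m : ℕ, P (-n + m) - P (-n) = ∑ i ∈ Finset.range m, (P (-n + i + 1) - P (-n + i)) := by
    intro m
    induction m with
    | zero => simp
    | succ m ih =>
      rw [Finset.sum_range_succ, ← ih]
      push_cast
      rw [← add_assoc]
      ring
  have h1 := htel (2 * n)
  have h2 : (-(n : ℤ) + ((2 * n : ℕ) : ℤ)) = n := by push_cast; ring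
  rw [h2] at h1
  rw [h1]
  refine (enorm_sum_le _ _).trans ?_
  have hinj : Function.Injective fun i : ℕ => -(n : ℤ) + i := fun a b h => by simpa using h
  calc ∑ i ∈ Finset.range (2 * n), ‖P (-n + i + 1) - P (-n + i)‖ₑ
      ≤ ∑' i : ℕ, ‖P (-n + i + 1) - P (-n + i)‖ₑ := ENNReal.sum_le_tsum _
    _ ≤ _ := ENNReal.tsum_comp_le_tsum_of_injective hinj fun j => ‖P (j + 1) - P j‖ₑ

theorem ENNReal.le_rpow_mul_rpow_of_le {a x y : ℝ≥0∞} {s : ℝ} (hs0 : 0 ≤ s) (hs1 : s ≤ 1)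
    (hx : a ≤ x) (hy : a ≤ y) : a ≤ x ^ (1 - s) * y ^ s := by
  calc a = a ^ (1 - s) * a ^ s := by
        rw [← ENNReal.rpow_add_of_nonneg _ _ (by linarith) hs0, sub_add_cancel, ENNReal.rpow_one]
    _ ≤ _ := by gcongr

/-- `v` is pointwise bounded by a product of powers of its norm, of the norm of `(-Δ)^(γ/2) v`
and of the maximal function of `(-Δ)^(γ/2) v`. -/
theorem exists_ae_enorm_le {N : ℕ} {p r γ s b θ : ℝ} (hN : 0 < N) (hp : 1 ≤ p) (hr : 1 < r)
    (hs0 : 0 < s) (hs1 : s ≤ 1) (hb : b = γ - (1 - s) * (N / r)) (hb0 : 0 < b)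
    (hθ : θ = N / p / (N / p + b)) :
    ∃ C : ℝ≥0∞, C ≠ ∞ ∧ ∀ v w : EuclideanSpace ℝ (Fin N) → ℝ,
      MemLp v (ENNReal.ofReal p) volume → MemLp w (ENNReal.ofReal r) volume →
      IsFracLaplacian γ v w → ∀ᵐ x, ‖v x‖ₑ ≤ C * (eLpNorm v (ENNReal.ofReal p) volume ^ (1 - θ) *
        (eLpNorm w (ENNReal.ofReal r) volume ^ (1 - s) *
          dyadicMaximal volume (fun y => ‖w y‖ₑ) x ^ s) ^ θ) := by
  have hN' : (0 : ℝ) < N := by exact_mod_cast hN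
  have : Nontrivial (EuclideanSpace ℝ (Fin N)) :=
    Module.nontrivial_of_finrank_pos (R := ℝ) (by simpa using hN)
  have ha0 : 0 < N / p := div_pos hN' (by linarith)
  obtain ⟨η, ψ, κ, hη, hψ, hκ⟩ := exists_littlewoodPaley_kernels N γ
  obtain ⟨C₁, hC₁t, hC₁⟩ := ψ.exists_lintegral_mul_dyadicDilate_le_eLpNorm volume hp
  obtain ⟨C₂, hC₂t, hC₂⟩ := κ.exists_lintegral_mul_dyadicDilate_le_eLpNorm volume hr.le
  obtain ⟨C₃, hC₃t, hC₃⟩ := κ.exists_lintegral_mul_dyadicDilate_le_dyadicMaximal volume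
  obtain ⟨C₄, -, hC₄t, hC₄⟩ := ENNReal.exists_tsum_int_min_le ha0 hb0
  set D := max C₁ (max C₂ C₃) with hD
  have hDt : D ≠ ∞ := by simp [hD, hC₁t, hC₂t, hC₃t]
  refine ⟨D * C₄, ENNReal.mul_ne_top hDt hC₄t, fun v w hv hw hvw => ?_⟩
  set A := eLpNorm w (ENNReal.ofReal r) volume
  set B := eLpNorm v (ENNReal.ofReal p) volume
  filter_upwards [η.ae_tendsto_integral_mul_dyadicDilate volume hp hv] with x hx
  rw [hη, mul_one] at hx
  set M := dyadicMaximal volume (fun y => ‖w y‖ₑ) x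
  have hsum := enorm_le_tsum_int_of_tendsto (P := fun j => ∫ y, (v y : ℂ) * dyadicDilate η j x y)
    hx (η.tendsto_integral_mul_dyadicDilate_neg volume hp hv x)
  rw [Complex.enorm_ofReal_eq] at hsum
  have hdiff : ∀ j : ℤ, (∫ y, (v y : ℂ) * dyadicDilate η (j + 1) x y) -
      ∫ y, (v y : ℂ) * dyadicDilate η j x y = ∫ y, (v y : ℂ) * dyadicDilate ψ j x y := by
    intro j
    rw [← integral_sub (η.integrable_mul_dyadicDilate volume hp hv _ x)
      (η.integrable_mul_dyadicDilate volume hp hv _ x)]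
    congr 1
    ext y
    rw [hψ, mul_sub]
  simp_rw [hdiff] at hsum
  refine hsum.trans ?_
  have hlow : ∀ j : ℤ, ‖∫ y, (v y : ℂ) * dyadicDilate ψ j x y‖ₑ ≤
      D * (2 ^ ((j : ℝ) * (N / p)) * B) := by
    intro j
    refine (enorm_integral_mul_dyadicDilate_le volume _ v j x).trans
      ((hC₁ v hv.1 j x).trans ?_)
    rw [finrank_euclideanSpace_fin]
    gcongr
    exact le_max_left _ _
  have heq : ∀ j : ℤ, ‖∫ y, (v y : ℂ) * dyadicDilate ψ j x y‖ₑ =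
      2 ^ (-((j : ℝ) * γ)) * ‖∫ y, (w y : ℂ) * dyadicDilate κ j x y‖ₑ := by
    intro j
    rw [← hκ v w hvw j x, enorm_mul, Complex.enorm_ofReal_eq, Real.enorm_of_nonneg (by positivity),
      ENNReal.ofReal_two_rpow, ← mul_assoc, ← ENNReal.two_rpow_add, neg_add_cancel,
      ENNReal.rpow_zero, one_mul]
  -- The geometric mean, with weights `1 - s` and `s`, of the Bernstein bound and the maximal bound
  -- on the averages of `w`.
  have hhigh : ∀ j : ℤ, ‖∫ y, (v y : ℂ) * dyadicDilate ψ j x y‖ₑ ≤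
      D * (2 ^ (-((j : ℝ) * b)) * (A ^ (1 - s) * M ^ s)) := by
    intro j
    have h2 : ‖∫ y, (w y : ℂ) * dyadicDilate κ j x y‖ₑ ≤ D * (2 ^ ((j : ℝ) * (N / r)) * A) := by
      refine (enorm_integral_mul_dyadicDilate_le volume _ w j x).trans
        ((hC₂ w hw.1 j x).trans ?_)
      rw [finrank_euclideanSpace_fin]
      gcongr
      exact (le_max_left _ _).trans (le_max_right _ _)
    have h3 : ‖∫ y, (w y : ℂ) * dyadicDilate κ j x y‖ₑ ≤ D * M := by
      refine (enorm_integral_mul_dyadicDilate_le volume _ w j x).trans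
        ((hC₃ _ hw.1.enorm j x).trans ?_)
      gcongr
      exact (le_max_right _ _).trans (le_max_right _ _)
    rw [heq]
    refine (mul_le_mul_right (ENNReal.le_rpow_mul_rpow_of_le hs0.le hs1 h2 h3) _).trans
      (le_of_eq ?_)
    rw [ENNReal.mul_rpow_of_nonneg _ _ (by linarith), ENNReal.mul_rpow_of_nonneg _ _ (by linarith),
      ENNReal.mul_rpow_of_nonneg _ _ hs0.le, ← ENNReal.rpow_mul]
    calc _ = (D ^ (1 - s) * D ^ s) * ((2 ^ (-((j : ℝ) * γ)) * 2 ^ ((j : ℝ) * (N / r) * (1 - s))) *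
          (A ^ (1 - s) * M ^ s)) := by ring
      _ = _ := by
        rw [← ENNReal.rpow_add_of_nonneg _ _ (by linarith) hs0.le, sub_add_cancel,
          ENNReal.rpow_one, ← ENNReal.two_rpow_add, hb]
        congr 3
        ring
  have hmin : ∀ j : ℤ, ‖∫ y, (v y : ℂ) * dyadicDilate ψ j x y‖ₑ ≤
      D * min (2 ^ ((j : ℝ) * (N / p)) * B) (2 ^ (-((j : ℝ) * b)) * (A ^ (1 - s) * M ^ s)) := by
    intro j
    rcases min_choice (2 ^ ((j : ℝ) * (N / p)) * B)
      (2 ^ (-((j : ℝ) * b)) * (A ^ (1 - s) * M ^ s)) with h | h <;> rw [h]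
    · exact hlow j
    · exact hhigh j
  refine (ENNReal.tsum_le_tsum hmin).trans ?_
  rw [ENNReal.tsum_mul_left, mul_assoc]
  refine mul_le_mul_right ((hC₄ B _).trans_eq ?_) D
  have hθ' : 1 - θ = b / (N / p + b) := by
    rw [hθ]
    field_simp
    ring
  rw [hθ', hθ]

theorem eLpNorm_ofReal_eq {E : Type*} [MeasurableSpace E] {μ : Measure E} {q : ℝ} (hq : 0 < q)
    (v : E → ℝ) : eLpNorm v (ENNReal.ofReal q) μ = (∫⁻ x, ‖v x‖ₑ ^ q ∂μ) ^ (1 / q) := by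
  rw [eLpNorm_eq_lintegral_rpow_enorm_toReal (by simpa using hq) ENNReal.ofReal_ne_top,
    ENNReal.toReal_ofReal hq.le]

/-- Log-convexity of the Lebesgue norms. -/
theorem eLpNorm_ofReal_le_rpow_mul_rpow {E : Type*} [MeasurableSpace E] {μ : Measure E}
    {p q t τ : ℝ} (hp : 0 < p) (hq : 0 < q) (ht : 0 < t) (hτ0 : 0 ≤ τ) (hτ1 : τ ≤ 1)
    (h : 1 / t = (1 - τ) / p + τ / q) {v : E → ℝ} (hv : AEStronglyMeasurable v μ) :
    eLpNorm v (ENNReal.ofReal t) μ ≤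
      eLpNorm v (ENNReal.ofReal p) μ ^ (1 - τ) * eLpNorm v (ENNReal.ofReal q) μ ^ τ := by
  rw [eLpNorm_ofReal_eq hp, eLpNorm_ofReal_eq hq, eLpNorm_ofReal_eq ht]
  have h1 : 0 ≤ (1 - τ) * t / p := div_nonneg (mul_nonneg (by linarith) ht.le) hp.le
  have h2 : 0 ≤ τ * t / q := by positivity
  have h12 : (1 - τ) * t / p + τ * t / q = 1 := by
    calc (1 - τ) * t / p + τ * t / q = t * ((1 - τ) / p + τ / q) := by ring
      _ = 1 := by rw [← h, mul_one_div_cancel ht.ne']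
  have hH := ENNReal.lintegral_mul_norm_pow_le (hv.enorm.pow_const p) (hv.enorm.pow_const q)
    h1 h2 h12
  have hL : ∀ x, (‖v x‖ₑ ^ p) ^ ((1 - τ) * t / p) * (‖v x‖ₑ ^ q) ^ (τ * t / q) = ‖v x‖ₑ ^ t := by
    intro x
    rw [← ENNReal.rpow_mul, ← ENNReal.rpow_mul, mul_div_cancel₀ _ hp.ne', mul_div_cancel₀ _ hq.ne',
      ← ENNReal.rpow_add_of_nonneg _ _ (mul_nonneg (by linarith) ht.le) (by positivity)]
    congr 1
    ring
  simp_rw [hL] at hH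
  refine (ENNReal.rpow_le_rpow hH (by positivity)).trans (le_of_eq ?_)
  rw [ENNReal.mul_rpow_of_nonneg _ _ (by positivity)]
  simp_rw [← ENNReal.rpow_mul]
  congr 2 <;> field_simp

/-- The exponent `r / (s * θ)` is the one for which the pointwise bound contains `M` to the power
`r` exactly, as the maximal theorem requires. -/
theorem exists_eLpNorm_le {N : ℕ} {p r γ s b θ : ℝ} (hN : 0 < N) (hp : 1 ≤ p) (hr : 1 < r)
    (hs0 : 0 < s) (hs1 : s ≤ 1) (hb : b = γ - (1 - s) * (N / r)) (hb0 : 0 < b)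
    (hθ : θ = N / p / (N / p + b)) :
    ∃ C : ℝ≥0∞, C ≠ ∞ ∧ ∀ v w : EuclideanSpace ℝ (Fin N) → ℝ,
      MemLp v (ENNReal.ofReal p) volume → MemLp w (ENNReal.ofReal r) volume →
      IsFracLaplacian γ v w → eLpNorm v (ENNReal.ofReal (r / (s * θ))) volume ≤
        C * (eLpNorm v (ENNReal.ofReal p) volume ^ (1 - θ) *
          eLpNorm w (ENNReal.ofReal r) volume ^ θ) := by
  have hN' : (0 : ℝ) < N := by exact_mod_cast hN
  have : Nontrivial (EuclideanSpace ℝ (Fin N)) :=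
    Module.nontrivial_of_finrank_pos (R := ℝ) (by simpa using hN)
  have ha0 : 0 < N / p := div_pos hN' (by linarith)
  have hθ0 : 0 < θ := by rw [hθ]; positivity
  have hθ1 : θ ≤ 1 := by
    rw [hθ, div_le_one (by positivity)]
    linarith
  have hr0 : 0 < r := by linarith
  obtain ⟨C₁, hC₁t, hC₁⟩ := exists_ae_enorm_le hN hp hr hs0 hs1 hb hb0 hθ
  obtain ⟨C₂, hC₂t, hC₂⟩ :=
    exists_lintegral_dyadicMaximal_rpow_le (volume : Measure (EuclideanSpace ℝ (Fin N))) hr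
  refine ⟨C₁ * C₂ ^ (s * θ / r), ENNReal.mul_ne_top hC₁t
    (ENNReal.rpow_ne_top_of_nonneg (by positivity) hC₂t), fun v w hv hw hvw => ?_⟩
  set A := eLpNorm w (ENNReal.ofReal r) volume with hA
  set B := eLpNorm v (ENNReal.ofReal p) volume
  set M := dyadicMaximal volume (fun y => ‖w y‖ₑ)
  set q := r / (s * θ) with hq
  have hq0 : 0 < q := by positivity
  have hqr : s * θ * q = r := by rw [hq]; field_simp
  have hMr : ∫⁻ x, M x ^ r ≤ C₂ * A ^ r := by
    refine (hC₂ _ hw.1.enorm).trans_eq ?_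
    rw [hA, eLpNorm_ofReal_eq hr0, ← ENNReal.rpow_mul, one_div_mul_cancel hr0.ne', ENNReal.rpow_one]
  set c := C₁ * (B ^ (1 - θ) * A ^ ((1 - s) * θ)) with hc
  have hct : c ≠ ∞ := ENNReal.mul_ne_top hC₁t (ENNReal.mul_ne_top
    (ENNReal.rpow_ne_top_of_nonneg (by linarith) hv.2.ne)
    (ENNReal.rpow_ne_top_of_nonneg (mul_nonneg (by linarith) hθ0.le) hw.2.ne))
  have hint : ∫⁻ x, ‖v x‖ₑ ^ q ≤ c ^ q * (C₂ * A ^ r) := by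
    calc ∫⁻ x, ‖v x‖ₑ ^ q ≤ ∫⁻ x, c ^ q * M x ^ r := by
          refine lintegral_mono_ae ((hC₁ v w hv hw hvw).mono fun x hx => ?_)
          refine (ENNReal.rpow_le_rpow hx hq0.le).trans_eq ?_
          rw [ENNReal.mul_rpow_of_nonneg (A ^ (1 - s)) _ hθ0.le, ← ENNReal.rpow_mul,
            ← ENNReal.rpow_mul, ← mul_assoc (B ^ (1 - θ)), ← mul_assoc C₁, ← hc,
            ENNReal.mul_rpow_of_nonneg _ _ hq0.le, ← ENNReal.rpow_mul, hqr]
      _ = c ^ q * ∫⁻ x, M x ^ r :=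
          lintegral_const_mul' _ _ (ENNReal.rpow_ne_top_of_nonneg hq0.le hct)
      _ ≤ _ := by gcongr
  rw [eLpNorm_ofReal_eq hq0]
  refine (ENNReal.rpow_le_rpow hint (by positivity)).trans (le_of_eq ?_)
  have hr1q : 1 / q = s * θ / r := by rw [hq, one_div_div]
  have hA' : A ^ θ = A ^ ((1 - s) * θ) * A ^ (s * θ) := by
    rw [← ENNReal.rpow_add_of_nonneg _ _ (mul_nonneg (by linarith) hθ0.le) (by positivity)]
    congr 1
    ring
  rw [ENNReal.mul_rpow_of_nonneg (c ^ q) _ (by positivity),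
    ENNReal.mul_rpow_of_nonneg C₂ _ (by positivity), ← ENNReal.rpow_mul, mul_one_div_cancel hq0.ne', ENNReal.rpow_one, ← ENNReal.rpow_mul, hr1q,
    mul_div_cancel₀ _ hr0.ne', hA', hc]
  ring

end Estimates

/-! ### Choice of exponents and interpolation with `L^p` -/

theorem mainTheorem10 (N : ℕ) (p r γ : ℝ) (hp : 1 ≤ p) (hr : 1 < r)
    (hγ : 0 < γ) (hγN : γ < min (N : ℝ) 2) :
    ∃ C : ℝ, 0 < C ∧
      ∀ v w : EuclideanSpace ℝ (Fin N) → ℝ,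
        MemLp v (ENNReal.ofReal p) volume →
        MemLp w (ENNReal.ofReal r) volume →
        IsFracLaplacian γ v w →
        MemLp v (ENNReal.ofReal (N * (r * p + r - p) / (r * (N - γ)))) volume ∧
        eLpNorm v (ENNReal.ofReal (N * (r * p + r - p) / (r * (N - γ)))) volume
            ^ (p * (r - 1) / r + 1) ≤
          ENNReal.ofReal C * eLpNorm w (ENNReal.ofReal r) volume *
            eLpNorm v (ENNReal.ofReal p) volume ^ (p * (r - 1) / r) := by
  have hγN' : γ < N := hγN.trans_le (min_le_left _ _)
  have hN' : (0 : ℝ) < N := hγ.trans hγN'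
  have hN : 0 < N := by exact_mod_cast hN'
  have hr0 : 0 < r := by linarith
  have hp0 : 0 < p := by linarith
  have hNγ : 0 < N - γ := by linarith
  set α := p * (r - 1) / r with hα
  have hα0 : 0 < α := div_pos (mul_pos hp0 (by linarith)) hr0
  have hnum : r * p + r - p = r * (α + 1) := by rw [hα]; field_simp; ring
  set t := N * (r * p + r - p) / (r * (N - γ)) with ht
  have htα : t = N * (α + 1) / (N - γ) := by
    rw [ht, hnum]
    field_simp
  have ht0 : 0 < t := by rw [htα]; positivity
  -- That is, `s = min 1 (r(1 - γ/N))`. Both cases give `0 < b ≤ (N/p) α`, with equality on the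
  -- right in the first.
  obtain ⟨s, hs0, hs1, hcases⟩ : ∃ s : ℝ, 0 < s ∧ s ≤ 1 ∧
      (s = r * (1 - γ / N) ∨ (s = 1 ∧ 1 ≤ r * (1 - γ / N))) := by
    have h1 : 0 < r * (1 - γ / N) := by
      have : γ / N < 1 := (div_lt_one hN').2 hγN'
      exact mul_pos hr0 (by linarith)
    rcases le_total (r * (1 - γ / N)) 1 with h | h
    · exact ⟨_, h1, h, Or.inl rfl⟩
    · exact ⟨1, one_pos, le_rfl, Or.inr ⟨rfl, h⟩⟩
  set b := γ - (1 - s) * (N / r) with hb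
  have hb0 : 0 < b := by
    rcases hcases with h | ⟨h, -⟩
    · have : b = N * (1 - 1 / r) := by rw [hb, h]; field_simp; ring
      rw [this]
      have : 1 / r < 1 := (div_lt_one hr0).2 hr
      exact mul_pos hN' (by linarith)
    · rw [hb, h]
      simpa using hγ
  have hbα : b ≤ N / p * α := by
    have h1 : N / p * α = N * (1 - 1 / r) := by rw [hα]; field_simp
    rw [h1]
    rcases hcases with h | ⟨h, h'⟩
    · rw [hb, h]
      exact le_of_eq (by field_simp; ring)
    · rw [hb, h]
      have h2 : 1 / r ≤ 1 - γ / N := by rwa [div_le_iff₀' hr0]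
      have h3 : N * (1 / r) ≤ N * (1 - γ / N) := by gcongr
      have h4 : N * (1 - γ / N) = N - γ := by field_simp
      linarith
  set θ := N / p / (N / p + b) with hθ
  have ha0 : 0 < N / p := by positivity
  have hθ0 : 0 < θ := by positivity
  -- Chosen so that, after raising to the power `α + 1`, the norm of `w` has exponent `1`; `τ ≤ 1`
  -- amounts to `b ≤ (N/p) α`.
  set τ := 1 / ((α + 1) * θ) with hτ
  have hτ0 : 0 < τ := by positivity
  have hτ1 : τ ≤ 1 := by
    rw [hτ, div_le_one (by positivity), hθ, mul_div_assoc', le_div_iff₀ (by positivity)]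
    linarith
  have hθτ : θ * τ * (α + 1) = 1 := by rw [hτ]; field_simp
  have hexp : 1 / t = (1 - τ) / p + τ / (r / (s * θ)) := by
    have h1 : τ * θ = 1 / (α + 1) := by rw [hτ]; field_simp
    have h2 : τ = (1 + b * p / N) / (α + 1) := by rw [hτ, hθ]; field_simp
    have h3 : (1 - τ) / p + τ / (r / (s * θ)) = (1 - τ) / p + τ * θ * s / r := by
      field_simp
    -- The parameter `s` cancels, so the interpolated exponent is `t` in both cases.
    have h4 : α / p - b / N + s / r = (N - γ) / N := by
      rw [hb, hα]
      field_simp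
      ring
    rw [h3, h1, h2, htα]
    calc 1 / (N * (α + 1) / (N - γ)) = ((N - γ) / N) / (α + 1) := by field_simp
      _ = (α / p - b / N + s / r) / (α + 1) := by rw [h4]
      _ = _ := by field_simp; ring
  obtain ⟨C, hCt, hC⟩ := exists_eLpNorm_le hN hp hr hs0 hs1 hb hb0 hθ
  -- Adding `1` keeps the constant positive even if `C = 0`.
  refine ⟨(C ^ (τ * (α + 1))).toReal + 1, by positivity, fun v w hv hw hvw => ?_⟩
  set A := eLpNorm w (ENNReal.ofReal r) volume
  set B := eLpNorm v (ENNReal.ofReal p) volume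
  have hθ1 : θ ≤ 1 := by
    rw [hθ, div_le_one (by positivity)]
    linarith
  have hmain : eLpNorm v (ENNReal.ofReal t) volume ≤ B ^ (1 - τ) * (C * (B ^ (1 - θ) * A ^ θ)) ^ τ :=
    (eLpNorm_ofReal_le_rpow_mul_rpow hp0 (by positivity) ht0 hτ0.le hτ1 hexp hv.1).trans
      (mul_le_mul_right (ENNReal.rpow_le_rpow (hC v w hv hw hvw) hτ0.le) _)
  refine ⟨⟨hv.1, hmain.trans_lt ?_⟩, ?_⟩
  · refine (ENNReal.mul_ne_top (ENNReal.rpow_ne_top_of_nonneg (by linarith) hv.2.ne)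
      (ENNReal.rpow_ne_top_of_nonneg hτ0.le (ENNReal.mul_ne_top hCt (ENNReal.mul_ne_top ?_ ?_)))).lt_top
    · exact ENNReal.rpow_ne_top_of_nonneg (by linarith) hv.2.ne
    · exact ENNReal.rpow_ne_top_of_nonneg hθ0.le hw.2.ne
  · have hα1 : 0 ≤ α + 1 := by linarith
    refine (ENNReal.rpow_le_rpow hmain hα1).trans ?_
    have hBexp : (1 - τ) * (α + 1) + (1 - θ) * (τ * (α + 1)) = α := by
      linear_combination -hθτ
    have hAexp : θ * (τ * (α + 1)) = 1 := by rw [← mul_assoc, hθτ]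
    have h1 : (B ^ (1 - τ) * (C * (B ^ (1 - θ) * A ^ θ)) ^ τ) ^ (α + 1) =
        C ^ (τ * (α + 1)) * A * B ^ α := by
      rw [ENNReal.mul_rpow_of_nonneg _ _ hα1, ← ENNReal.rpow_mul, ← ENNReal.rpow_mul,
        ENNReal.mul_rpow_of_nonneg _ _ (by positivity),
        ENNReal.mul_rpow_of_nonneg _ _ (by positivity), ← ENNReal.rpow_mul, ← ENNReal.rpow_mul,
        hAexp, ENNReal.rpow_one]
      have h2 : B ^ α = B ^ ((1 - τ) * (α + 1)) * B ^ ((1 - θ) * (τ * (α + 1))) := by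
        rw [← ENNReal.rpow_add_of_nonneg _ _ (mul_nonneg (by linarith) hα1)
          (mul_nonneg (by linarith) (by positivity)), hBexp]
      rw [h2]
      ring
    rw [h1]
    gcongr
    calc C ^ (τ * (α + 1)) = ENNReal.ofReal (C ^ (τ * (α + 1))).toReal :=
          (ENNReal.ofReal_toReal (ENNReal.rpow_ne_top_of_nonneg (by positivity) hCt)).symm
      _ ≤ _ := ENNReal.ofReal_le_ofReal (by linarith)
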